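/- Let $\mathcal{C}$ be a small category with finite colimits and let $\mathcal{N}\subseteq\mathcal{C}$ be a subcategory that contains all isomorphisms of $\mathcal{C}$ and is closed under cobase change (if a morphism of $\mathcal{N}$ is pushed out in $\mathcal{C}$ along any morphism, the result is in $\mathcal{N}$). Let $\mathrm{Ind}(\mathcal{C})$ be the category of ind-objects of $\mathcal{C}$, which has all small colimits, and regard $\mathcal{C}$ as a full subcategory of it. Let $\mathrm{cell}(\mathcal{N})$ be the class of relative $\mathcal{N}$-cell complexes in $\mathrm{Ind}(\mathcal{C})$: the transfinite compositions, along small non-zero ordinals, of pushouts in $\mathrm{Ind}(\mathcal{C})$ of morphisms of $\mathcal{N}$. Let $\mathrm{coSp}^{\cong}(\mathcal{N})$ be the class of essentially cospecial $\mathcal{N}$-maps: the morphisms of $\mathrm{Ind}(\mathcal{C})$ that are isomorphic, in the category of morphisms of $\mathrm{Ind}(\mathcal{C})$, to the morphism induced by a natural transformation $X\to Y$ of diagrams $X,Y:T\to\mathcal{C}$, where $T$ is a small non-empty directed poset in which every set $\{s\in T : s\le t\}$ is finite, such that for every $t\in T$ the natural map $$X_t\coprod_{\operatorname{colim}_{s<t}X_s}\operatorname{colim}_{s<t}Y_s\longrightarrow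 Y_t$$ belongs to $\mathcal{N}$. For a class $M$ of morphisms of $\mathrm{Ind}(\mathcal{C})$ let $R(M)$ be the class of retracts (in the category of morphisms) of elements of $M$. Then $$R(\mathrm{cell}(\mathcal{N}))=R(\mathrm{coSp}^{\cong}(\mathcal{N})).$$ In particular $R(\mathrm{cell}(\mathcal{N}))\subseteq R(\mathrm{coSp}^{\cong}(\mathcal{N}))$, that is, Isaksen's conjecture holds for such $\mathcal{N}$. -/

import Mathlib

open CategoryTheory CategoryTheory.Limits

universe w v u

/-- A poset is cofinite if the set of elements below any given element is finite. -/
class IsCofinitePoset (T : Type w) [PartialOrder T] : Prop where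
  finite_Iic (t : T) : (Set.Iic t).Finite

theorem IsCofinitePoset.finite_Iio {T : Type w} [PartialOrder T] [IsCofinitePoset T] (t : T) :
    Finite (Set.Iio t) :=
  ((IsCofinitePoset.finite_Iic t).subset Set.Iio_subset_Iic_self).to_subtype

section Cospecial

variable {C : Type u} [Category.{v} C] [HasFiniteColimits C]
  {T : Type w} [PartialOrder T] [IsCofinitePoset T]

instance hasColimitsOfShape_Iio (t : T) : HasColimitsOfShape (Set.Iio t) C := by
  classical
  have := IsCofinitePoset.finite_Iio t
  let := Fintype.ofFinite (Set.Iio t)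
  let : FinCategory (Set.Iio t) :=
    { fintypeHom := fun a b => Fintype.ofFinite (a ⟶ b) }
  infer_instance

/-- The restriction of a diagram `X : T ⥤ C` to the set of elements `s < t`. -/
abbrev restrictIio (X : T ⥤ C) (t : T) : Set.Iio t ⥤ C :=
  (Set.principalSegIio t).monotone.functor ⋙ X

/-- The latching object `colim_{s < t} X_s`. -/
noncomputable abbrev latchingObj (X : T ⥤ C) (t : T) : C :=
  colimit (restrictIio X t)

/-- The canonical map `colim_{s < t} X_s ⟶ X_t`, induced by the maps `X_s ⟶ X_t`. -/
noncomputable def latchingMap (X : T ⥤ C) (t : T) : latchingObj X t ⟶ X.obj t :=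
  colimit.desc (restrictIio X t) ((Set.principalSegIio t).cocone X)

/-- The map `colim_{s < t} X_s ⟶ colim_{s < t} Y_s` induced by `φ : X ⟶ Y`. -/
noncomputable def latchingObjMap {X Y : T ⥤ C} (φ : X ⟶ Y) (t : T) :
    latchingObj X t ⟶ latchingObj Y t :=
  colimMap (Functor.whiskerLeft (Set.principalSegIio t).monotone.functor φ)

theorem latching_comm {X Y : T ⥤ C} (φ : X ⟶ Y) (t : T) :
    latchingMap X t ≫ φ.app t = latchingObjMap φ t ≫ latchingMap Y t := by
  apply colimit.hom_ext
  intro s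
  have hs : s.1 ≤ t := le_of_lt s.2
  have h₁ : colimit.ι (restrictIio X t) s ≫ latchingObjMap φ t =
      φ.app s.1 ≫ colimit.ι (restrictIio Y t) s := ι_colimMap _ _
  have h₂ : colimit.ι (restrictIio Y t) s ≫ latchingMap Y t = Y.map (homOfLE hs) :=
    colimit.ι_desc _ s
  have h₃ : colimit.ι (restrictIio X t) s ≫ latchingMap X t = X.map (homOfLE hs) :=
    colimit.ι_desc _ s
  have e₁ := (Category.assoc _ _ _).symm.trans (congrArg (· ≫ φ.app t) h₃)
  have e₂ := (Category.assoc _ _ _).symm.trans (congrArg (· ≫ latchingMap Y t) h₁)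
  have e₃ := (Category.assoc _ _ _).trans (congrArg (φ.app s.1 ≫ ·) h₂)
  exact e₁.trans ((φ.naturality (homOfLE hs)).trans (e₂.trans e₃).symm)

/-- The natural map `X_t ⨿_{colim_{s < t} X_s} colim_{s < t} Y_s ⟶ Y_t`. -/
noncomputable def relativeLatchingMap {X Y : T ⥤ C} (φ : X ⟶ Y) (t : T) :
    pushout (latchingMap X t) (latchingObjMap φ t) ⟶ Y.obj t :=
  pushout.desc (φ.app t) (latchingMap Y t) (latching_comm φ t)

/-- A natural transformation between diagrams indexed by a cofinite poset is a cospecial `N`-map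
if all its relative latching maps are in `N`. -/
def IsCospecial (N : MorphismProperty C) {X Y : T ⥤ C} (φ : X ⟶ Y) : Prop :=
  ∀ t : T, N (relativeLatchingMap φ t)

end Cospecial

/-- Essentially cospecial `N`-maps: the morphisms of `Ind C` isomorphic, in the category of
morphisms of `Ind C`, to the morphism induced by a cospecial `N`-map between diagrams
indexed by a (small) cofinite directed poset. -/
def essentiallyCospecial {C : Type u} [SmallCategory C] [HasFiniteColimits C]
    (N : MorphismProperty C) : MorphismProperty (Ind C) :=
  fun _ _ f => ∃ (T : Type u) (_ : PartialOrder T) (_ : IsCofinitePoset T)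
    (_ : Nonempty T) (_ : IsDirectedOrder T) (X Y : T ⥤ C) (φ : X ⟶ Y),
      IsCospecial N φ ∧ Nonempty (Arrow.mk f ≅ Arrow.mk ((Ind.lim T).map φ))

/-- Relative `W`-cell complexes: transfinite compositions (along small ordinals) of pushouts of
elements of `W`. -/
def relativeCellComplexes {D : Type u} [Category.{v} D] (W : MorphismProperty D) :
    MorphismProperty D :=
  MorphismProperty.transfiniteCompositions.{v} W.pushouts

/-!
Write `M` for the image of `N` in `Ind C`, and `coSp N` for the essentially cospecial `N`-maps. The
equality follows, by closing under retracts, from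
`cell M ≤ llp (rlp M) ≤ R (coSp N)` and `coSp N ≤ cell M`.

*Cell complexes lift* (`relativeCellComplexes_le_llp_rlp`): pushouts and transfinite compositions
inherit left lifting properties.

*Lifting implies retract of cospecial* (`llp_rlp_le_retracts_essentiallyCospecial`): by the retract
argument it suffices to factor every morphism `f : A ⟶ B` of `Ind C` as an essentially cospecial
`N`-map followed by a morphism in `rlp M` (`Ind.exists_isCospecial_comp_rlp`). The indexing poset
`T` is obtained from hereditarily finite names of the objects of `C ↓ f`, the category of morphisms
`x ⟶ y` of `C` with a square to `f`: a name is a finite list of names together with morphisms from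
the objects which they name, and only the names that encode a commutative diagram indexed by a
finite poset are retained. Names are well-founded with finitely many predecessors, so they form a
cofinite poset, with a tautological diagram of squares `X_t ⟶ Y_t`, and by construction every cocone
over a finite lower set of it is the value of the diagram at some later index
(`exists_cofinite_diagram_extending`). Keeping only the indices below which all relative latching
maps are in `N`, one gets a cospecial `N`-map `X ⟶ Y` over `f` in which every cocone with relative
latching map in `N` still occurs (`exists_isCospecial_extending`). There are many such cocones,
since `N` contains the identities and is closed under cobase change, and each yields a property
of `colim X ⟶ colim Y`:
- the colimit of a finite lower set gives an upper bound, so `T` is directed;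
- the square given by `𝟙 K` and a morphism `K ⟶ A` makes `colim X ⟶ A` surjective on morphisms from
  `K`, and pushing `X_t ⟶ Y_t` out along a coequalizer `X_t ⟶ x'` makes it injective, so that
  `colim X ≅ A`, because ind-objects are determined by the morphisms from objects of `C`;
- keeping `X_t` and pushing a morphism of `N` out along `K ⟶ Y_t` solves a lifting problem, so
  `colim Y ⟶ B` is in `rlp M`. Here and above, morphisms from `K` to a filtered colimit factor
  through some stage.

*Cospecial maps are cell complexes* (`essentiallyCospecial_le_relativeCellComplexes`): extend the
order of `T` to a well-order. For a lower set `S` of `T`, let `P_S` be the pushout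
`colim X ⨿_{colim_S X} colim_S Y`. Along the initial segments of the well-order, `P_S` runs from
`colim X` to `colim Y`, is continuous (`partialColimit.isColimitMapCocone`), and adding one element
`t` to `S` is a pushout along the relative latching map at `t` (`partialColimit.isPushout_insert`).
-/

/-! ### A cofinite poset of formal cocones -/

section FormalCocones

variable {E : Type u} [Category.{v} E]

/-- Hereditarily finite names for objects of `E`: a name of `e` lists finitely many morphisms into
`e`, together with names of their sources. -/
inductive ObjName (E : Type u) [Category.{v} E] : E → Type (max u v)
  | mk {n : ℕ} {d : Fin n → E} (s : ∀ i, ObjName E (d i)) {e : E} (h : ∀ i, d i ⟶ e) :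
      ObjName E e

/-- `ChildHom x y g` says that the pair `(x, g)` is one of the entries of the name `y`. -/
inductive ChildHom : ∀ (x y : Σ e, ObjName E e), (x.1 ⟶ y.1) → Prop
  | mk {n : ℕ} {d : Fin n → E} (s : ∀ i, ObjName E (d i)) {e : E} (h : ∀ i, d i ⟶ e) (i : Fin n) :
      ChildHom ⟨d i, s i⟩ ⟨e, .mk s h⟩ (h i)

/-- The names that encode a commutative diagram indexed by a finite poset with a top element:
there is at most one listed morphism from each child, and the children of a child are children,
through the composite morphism. -/
inductive IsCoherent : (Σ e, ObjName E e) → Prop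
  | mk {y : Σ e, ObjName E e}
      (child : ∀ x g, ChildHom x y g → IsCoherent x)
      (unique : ∀ x g g', ChildHom x y g → ChildHom x y g' → g = g')
      (comp : ∀ x z g g', ChildHom z x g' → ChildHom x y g → ChildHom z y (g' ≫ g)) :
      IsCoherent y

theorem IsCoherent.of_childHom {x y : Σ e, ObjName E e} (hy : IsCoherent y) {g : x.1 ⟶ y.1}
    (h : ChildHom x y g) : IsCoherent x := by
  cases hy with
  | mk child _ _ => exact child _ _ h

theorem ChildHom.wellFounded :
    WellFounded fun x y : Σ e, ObjName E e => ∃ g, ChildHom x y g := by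
  constructor
  rintro ⟨e, y⟩
  induction y with
  | mk s h ih =>
    constructor
    rintro _ ⟨g, hg⟩
    cases hg with
    | mk _ _ i => exact ih i

theorem ChildHom.finite (y : Σ e, ObjName E e) : {x | ∃ g, ChildHom x y g}.Finite := by
  obtain ⟨e, s, h⟩ := y
  rename_i n d
  refine (Set.finite_range fun i => (⟨d i, s i⟩ : Σ e, ObjName E e)).subset ?_
  rintro _ ⟨g, hg⟩
  cases hg with
  | mk _ _ i => exact ⟨i, rfl⟩

theorem ChildHom.irrefl (x : Σ e, ObjName E e) (g) : ¬ ChildHom x x g :=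
  fun h => ChildHom.wellFounded.irrefl.irrefl x ⟨g, h⟩

variable (E) in
/-- The coherent names, ordered by the reflexive closure of the relation "is a child of". -/
structure CoherentName : Type (max u v) where
  /-- the underlying name, together with the object it names -/
  name : Σ e, ObjName E e
  isCoherent : IsCoherent name

namespace CoherentName

@[ext]
theorem ext {x y : CoherentName E} (h : x.name = y.name) : x = y := by
  cases x; cases y; cases h; rfl

/-- The object of `E` with the given name. -/
abbrev obj (x : CoherentName E) : E := x.name.1

/-- The morphisms of `E` attached to an inequality of coherent names: those listed in the larger
name, and the identities. -/
def IsStructureHom (x y : CoherentName E) (g : x.obj ⟶ y.obj) : Prop :=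
  ChildHom x.name y.name g ∨ ∃ h : x = y, g = eqToHom (by rw [h])

theorem IsStructureHom.comp {x y z : CoherentName E} {g : x.obj ⟶ y.obj} {g' : y.obj ⟶ z.obj}
    (h : IsStructureHom x y g) (h' : IsStructureHom y z g') : IsStructureHom x z (g ≫ g') := by
  obtain h | ⟨rfl, rfl⟩ := h
  · obtain h' | ⟨rfl, rfl⟩ := h'
    · left
      obtain ⟨z, hz⟩ := z
      cases hz with
      | mk _ _ comp => exact comp _ _ _ _ h h'
    · rw [eqToHom_refl, Category.comp_id]
      exact Or.inl h
  · rwa [eqToHom_refl, Category.id_comp]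

theorem IsStructureHom.unique {x y : CoherentName E} {g g' : x.obj ⟶ y.obj}
    (h : IsStructureHom x y g) (h' : IsStructureHom x y g') : g = g' := by
  obtain h | ⟨rfl, rfl⟩ := h
  · obtain h' | ⟨rfl, rfl⟩ := h'
    · obtain ⟨y, hy⟩ := y
      cases hy with
      | mk _ unique _ => exact unique _ _ _ h h'
    · exact (ChildHom.irrefl _ _ h).elim
  · obtain h' | ⟨_, rfl⟩ := h'
    · exact (ChildHom.irrefl _ _ h').elim
    · rfl

instance : PartialOrder (CoherentName E) where
  le x y := ∃ g, IsStructureHom x y g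
  le_refl x := ⟨𝟙 _, Or.inr ⟨rfl, rfl⟩⟩
  le_trans x y z := fun ⟨_, h⟩ ⟨_, h'⟩ => ⟨_, h.comp h'⟩
  le_antisymm x y := by
    rintro ⟨g, h | ⟨rfl, _⟩⟩ ⟨g', h' | ⟨h', _⟩⟩
    · exact (ChildHom.wellFounded.asymmetric x.name y.name ⟨_, h⟩ ⟨_, h'⟩).elim
    · exact h'.symm
    · rfl
    · rfl

theorem lt_iff {x y : CoherentName E} : x < y ↔ ∃ g, ChildHom x.name y.name g := by
  rw [lt_iff_le_and_ne]
  constructor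
  · rintro ⟨⟨g, h | ⟨h, _⟩⟩, hne⟩
    · exact ⟨g, h⟩
    · exact (hne h).elim
  · rintro ⟨g, h⟩
    refine ⟨⟨g, Or.inl h⟩, ?_⟩
    rintro rfl
    exact ChildHom.irrefl _ _ h

instance : IsCofinitePoset (CoherentName E) where
  finite_Iic y := by
    have hinj : Function.Injective (CoherentName.name (E := E)) := fun _ _ => CoherentName.ext
    refine ((((ChildHom.finite y.name).preimage hinj.injOn).union
      (Set.finite_singleton y))).subset fun x hx => ?_
    obtain rfl | h := eq_or_lt_of_le (Set.mem_Iic.1 hx)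
    · exact Or.inr rfl
    · exact Or.inl (lt_iff.1 h)

variable (E) in
/-- The tautological diagram, sending a name to the object it names. -/
@[simps obj]
noncomputable def diagram : CoherentName E ⥤ E where
  obj x := x.obj
  map f := (leOfHom f).choose
  map_id x := (leOfHom (𝟙 x)).choose_spec.unique (Or.inr ⟨rfl, rfl⟩)
  map_comp f g := (leOfHom (f ≫ g)).choose_spec.unique
    ((leOfHom f).choose_spec.comp (leOfHom g).choose_spec)

theorem isStructureHom_diagram_map {x y : CoherentName E} (f : x ⟶ y) :
    IsStructureHom x y ((diagram E).map f) :=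
  (leOfHom f).choose_spec

/-- Every cocone over the restriction of the tautological diagram to a finite lower set `S` is
named by an element whose strict predecessors are the elements of `S`. -/
theorem exists_extension (S : Set (CoherentName E)) (hS : S.Finite) (hS' : IsLowerSet S) (e : E)
    (α : ∀ s ∈ S, s.obj ⟶ e)
    (hα : ∀ s s' g (hs : s ∈ S) (hs' : s' ∈ S), IsStructureHom s s' g → g ≫ α s' hs' = α s hs) :
    ∃ (t : CoherentName E) (_ : Set.Iio t = S) (i : t.obj ≅ e),
      ∀ s g (hs : s ∈ S), IsStructureHom s t g → g ≫ i.hom = α s hs := by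
  obtain ⟨y, key⟩ : ∃ y : ObjName E e, ∀ x g, ChildHom x ⟨e, y⟩ g ↔
      ∃ (s : CoherentName E) (hs : s ∈ S) (h : x = s.name),
        g = eqToHom (by rw [h]) ≫ α s hs := by
    have := hS.to_subtype
    obtain ⟨n, ⟨σ⟩⟩ := Finite.exists_equiv_fin S
    refine ⟨.mk (fun i => (σ.symm i).1.name.2) fun i => α (σ.symm i).1 (σ.symm i).2, ?_⟩
    intro x g
    constructor
    · intro h
      cases h with
      | mk _ _ i => exact ⟨(σ.symm i).1, (σ.symm i).2, rfl, (Category.id_comp _).symm⟩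
    · rintro ⟨s, hs, rfl, rfl⟩
      obtain ⟨i, hi⟩ := σ.symm.surjective ⟨s, hs⟩
      obtain rfl : (σ.symm i).1 = s := by rw [hi]
      rw [eqToHom_refl, Category.id_comp]
      exact ChildHom.mk (fun i => (σ.symm i).1.name.2)
        (fun i => α (σ.symm i).1 (σ.symm i).2) i
  have key' (s : CoherentName E) (hs : s ∈ S) : ChildHom s.name ⟨e, y⟩ (α s hs) :=
    (key _ _).2 ⟨s, hs, rfl, (Category.id_comp _).symm⟩
  have hy : IsCoherent ⟨e, y⟩ := by
    refine .mk ?_ ?_ ?_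
    · intro x g h
      obtain ⟨s, hs, rfl, rfl⟩ := (key _ _).1 h
      exact s.isCoherent
    · intro x g g' h h'
      obtain ⟨s, hs, rfl, rfl⟩ := (key _ _).1 h
      obtain ⟨s', hs', h, rfl⟩ := (key _ _).1 h'
      obtain rfl := CoherentName.ext h
      rfl
    · intro x z g g' h h'
      obtain ⟨s, hs, rfl, rfl⟩ := (key _ _).1 h'
      have hz : IsCoherent z := s.isCoherent.of_childHom h
      have hle : (⟨z, hz⟩ : CoherentName E) ≤ s := ⟨_, Or.inl h⟩
      rw [eqToHom_refl, Category.id_comp, hα ⟨z, hz⟩ s g' (hS' hle hs) hs (Or.inl h)]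
      exact key' ⟨z, hz⟩ _
  have hlt (s : CoherentName E) : s < ⟨⟨e, y⟩, hy⟩ ↔ s ∈ S := by
    rw [lt_iff]
    constructor
    · rintro ⟨g, hg⟩
      obtain ⟨s', hs', h, _⟩ := (key _ _).1 hg
      obtain rfl := CoherentName.ext h
      exact hs'
    · intro hs
      exact ⟨_, key' s hs⟩
  refine ⟨⟨⟨e, y⟩, hy⟩, Set.ext hlt, Iso.refl _, ?_⟩
  intro s g hs hg
  exact (Category.comp_id _).trans (hg.unique (Or.inl (key' s hs)))

end CoherentName

/-- Every category `E` has a diagram indexed by a cofinite poset `T` in which every cocone over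
every finite lower set `S` of `T` occurs: its point is isomorphic to the value of the diagram at
some `t` whose strict predecessors are the elements of `S`. -/
theorem exists_cofinite_diagram_extending (E : Type u) [Category.{v} E] :
    ∃ (T : Type (max u v)) (_ : PartialOrder T) (_ : IsCofinitePoset T) (F : T ⥤ E),
      ∀ (S : Set T) (_ : S.Finite) (_ : IsLowerSet S) (e : E) (α : ∀ s ∈ S, F.obj s ⟶ e)
        (_ : ∀ s s' (h : s ≤ s') (hs : s ∈ S) (hs' : s' ∈ S),
          F.map (homOfLE h) ≫ α s' hs' = α s hs),
      ∃ (t : T) (_ : Set.Iio t = S) (i : F.obj t ≅ e),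
        ∀ s (h : s ≤ t) (hs : s ∈ S), F.map (homOfLE h) ≫ i.hom = α s hs := by
  refine ⟨CoherentName E, inferInstance, inferInstance, CoherentName.diagram E, ?_⟩
  intro S hS hS' e α hα
  obtain ⟨t, ht, i, hi⟩ := CoherentName.exists_extension S hS hS' e α fun s s' g hs hs' hg => by
    rw [← hα s s' ⟨g, hg⟩ hs hs', (CoherentName.isStructureHom_diagram_map _).unique hg]
    rfl
  exact ⟨t, ht, i, fun s h hs => hi s _ hs (CoherentName.isStructureHom_diagram_map _)⟩

end FormalCocones

/-! ### The filtration of a colimit of maps by lower sets -/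

section PartialColimit

variable {D : Type u} [Category.{v} D] {T : Type w} [PartialOrder T] {X Y : T ⥤ D} (φ : X ⟶ Y)

/-- The restriction of a diagram `X : T ⥤ D` to a subset of `T`. -/
abbrev restrictSet (X : T ⥤ D) (S : Set T) : S ⥤ D where
  obj s := X.obj s.1
  map f := X.map (homOfLE (leOfHom f))
  map_id s := X.map_id s.1
  map_comp f g := X.map_comp (homOfLE (leOfHom f)) (homOfLE (leOfHom g))

/-- The cocone over the restriction of `X` to `S` given by a compatible family of morphisms. -/
abbrev restrictSetCocone {X : T ⥤ D} {S : Set T} {Z : D} (α : ∀ s ∈ S, X.obj s ⟶ Z)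
    (hα : ∀ s s' (h : s ≤ s') (hs : s ∈ S) (hs' : s' ∈ S),
      X.map (homOfLE h) ≫ α s' hs' = α s hs) : Cocone (restrictSet X S) where
  pt := Z
  ι.app s := α s.1 s.2
  ι.naturality s s' f := (hα s.1 s'.1 (leOfHom f) s.2 s'.2).trans (Category.comp_id _).symm

/-- The restriction of a natural transformation to a subset of `T`. -/
abbrev restrictSetMap (φ : X ⟶ Y) (S : Set T) : restrictSet X S ⟶ restrictSet Y S where
  app s := φ.app s.1
  naturality _ _ f := φ.naturality (homOfLE (leOfHom f))

/-- A cocone over the diagram formed by all `X_t` and those `Y_s` with `s ∈ S`; the object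
`partialColimit φ S` is its colimit. -/
structure PartialCocone (S : Set T) (Z : D) where
  /-- the leg at `X_t` -/
  x (t : T) : X.obj t ⟶ Z
  /-- the leg at `Y_s` -/
  y (s : T) (hs : s ∈ S) : Y.obj s ⟶ Z
  x_w {t t' : T} (h : t ≤ t') : X.map (homOfLE h) ≫ x t' = x t := by cat_disch
  y_w {s s' : T} (h : s ≤ s') (hs : s ∈ S) (hs' : s' ∈ S) :
    Y.map (homOfLE h) ≫ y s' hs' = y s hs := by cat_disch
  app_y (s : T) (hs : s ∈ S) : φ.app s ≫ y s hs = x s := by cat_disch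

namespace PartialCocone

variable {φ} {S : Set T} {Z : D} (c : PartialCocone φ S Z)

theorem x_w_assoc {t t' : T} (h : t ≤ t') {W : D} (g : Z ⟶ W) :
    X.map (homOfLE h) ≫ c.x t' ≫ g = c.x t ≫ g := by
  rw [← Category.assoc, c.x_w]

theorem y_w_assoc {s s' : T} (h : s ≤ s') (hs : s ∈ S) (hs' : s' ∈ S) {W : D} (g : Z ⟶ W) :
    Y.map (homOfLE h) ≫ c.y s' hs' ≫ g = c.y s hs ≫ g := by
  rw [← Category.assoc, c.y_w]

theorem app_y_assoc (s : T) (hs : s ∈ S) {W : D} (g : Z ⟶ W) :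
    φ.app s ≫ c.y s hs ≫ g = c.x s ≫ g := by
  rw [← Category.assoc, c.app_y]

end PartialCocone

variable [HasColimitsOfSize.{w, w} D]

/-- The pushout `colim X ⨿_{colim_S X} colim_S Y`, where `colim_S` is the colimit over `S ⊆ T`. -/
noncomputable abbrev partialColimit (S : Set T) : D :=
  pushout (colimit.desc (restrictSet X S)
    (restrictSetCocone (fun s _ => colimit.ι X s) fun _ _ _ _ _ => colimit.w X _))
    (colimMap (restrictSetMap φ S))

namespace partialColimit

variable {φ} {S S' : Set T}

/-- The coprojection of `X_t` into the partial colimit. -/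
noncomputable def inX (φ : X ⟶ Y) (S : Set T) (t : T) : X.obj t ⟶ partialColimit φ S :=
  colimit.ι X t ≫ pushout.inl _ _

/-- The coprojection of `Y_s`, for `s ∈ S`, into the partial colimit. -/
noncomputable def inY (φ : X ⟶ Y) (S : Set T) (s : T) (hs : s ∈ S) :
    Y.obj s ⟶ partialColimit φ S :=
  colimit.ι (restrictSet Y S) ⟨s, hs⟩ ≫ pushout.inr _ _

variable (φ S) in
/-- The colimit cocone of the partial colimit. -/
noncomputable def cocone : PartialCocone φ S (partialColimit φ S) where
  x := inX φ S
  y := inY φ S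
  x_w h := by simp only [inX, colimit.w_assoc]
  y_w {s s'} h hs hs' := by
    simp only [inY, ← colimit.w_assoc (restrictSet Y S)
      (homOfLE h : (⟨s, hs⟩ : S) ⟶ ⟨s', hs'⟩)]
  app_y s hs := by
    have e := colimit.ι (restrictSet X S) ⟨s, hs⟩ ≫= pushout.condition
      (f := colimit.desc (restrictSet X S)
        (restrictSetCocone (fun s _ => colimit.ι X s) fun _ _ _ _ _ => colimit.w X _))
      (g := colimMap (restrictSetMap φ S))
    rw [colimit.ι_desc_assoc, ι_colimMap_assoc] at e
    exact e.symm

/-- The morphism out of the partial colimit given by a partial cocone. -/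
noncomputable def desc {Z : D} (c : PartialCocone φ S Z) : partialColimit φ S ⟶ Z :=
  pushout.desc
    (colimit.desc X ⟨Z,
      { app := c.x
        naturality := fun t t' f => (c.x_w (leOfHom f)).trans (Category.comp_id _).symm }⟩)
    (colimit.desc (restrictSet Y S) (restrictSetCocone c.y fun _ _ h _ _ => c.y_w h _ _))
    (by
      ext s
      simp only [colimit.ι_desc_assoc, ι_colimMap_assoc, colimit.ι_desc]
      exact (c.app_y s.1 s.2).symm)

theorem inX_desc {Z : D} (c : PartialCocone φ S Z) (t : T) : inX φ S t ≫ desc c = c.x t := by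
  simp only [inX, desc, Category.assoc, pushout.inl_desc, colimit.ι_desc]

theorem inX_desc_assoc {Z W : D} (c : PartialCocone φ S Z) (t : T) (g : Z ⟶ W) :
    inX φ S t ≫ desc c ≫ g = c.x t ≫ g := by
  rw [← Category.assoc, inX_desc]

theorem inY_desc {Z : D} (c : PartialCocone φ S Z) (s : T) (hs : s ∈ S) :
    inY φ S s hs ≫ desc c = c.y s hs := by
  simp only [inY, desc, Category.assoc, pushout.inr_desc, colimit.ι_desc]

theorem inY_desc_assoc {Z W : D} (c : PartialCocone φ S Z) (s : T) (hs : s ∈ S) (g : Z ⟶ W) :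
    inY φ S s hs ≫ desc c ≫ g = c.y s hs ≫ g := by
  rw [← Category.assoc, inY_desc]

theorem hom_ext {Z : D} {f g : partialColimit φ S ⟶ Z} (h : ∀ t, inX φ S t ≫ f = inX φ S t ≫ g)
    (h' : ∀ s hs, inY φ S s hs ≫ f = inY φ S s hs ≫ g) : f = g := by
  apply pushout.hom_ext
  · ext t
    simpa [inX] using h t
  · ext s
    simpa [inY] using h' s.1 s.2

/-- The restriction of a partial cocone to a smaller set of indices. -/
abbrev _root_.PartialCocone.restrict {Z : D} (c : PartialCocone φ S' Z) (h : S ⊆ S') :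
    PartialCocone φ S Z where
  x := c.x
  y s hs := c.y s (h hs)
  x_w := c.x_w
  y_w h' _ _ := c.y_w h' _ _
  app_y s _ := c.app_y s _

variable (φ) in
/-- Partial colimits are functorial in the set of indices. -/
noncomputable def map (h : S ⊆ S') : partialColimit φ S ⟶ partialColimit φ S' :=
  desc ((cocone φ S').restrict h)

theorem inX_map (h : S ⊆ S') (t : T) : inX φ S t ≫ map φ h = inX φ S' t :=
  inX_desc _ t

theorem inY_map (h : S ⊆ S') (s : T) (hs : s ∈ S) :
    inY φ S s hs ≫ map φ h = inY φ S' s (h hs) :=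
  inY_desc _ s hs

theorem inX_map_assoc (h : S ⊆ S') (t : T) {Z : D} (g : partialColimit φ S' ⟶ Z) :
    inX φ S t ≫ map φ h ≫ g = inX φ S' t ≫ g := by
  rw [← Category.assoc, inX_map]

theorem inY_map_assoc (h : S ⊆ S') (s : T) (hs : s ∈ S) {Z : D} (g : partialColimit φ S' ⟶ Z) :
    inY φ S s hs ≫ map φ h ≫ g = inY φ S' s (h hs) ≫ g := by
  rw [← Category.assoc, inY_map]

variable (φ) in
/-- The functor sending a set of indices to the partial colimit. -/
noncomputable abbrev functor : Set T ⥤ D where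
  obj := partialColimit φ
  map f := map φ (leOfHom f)
  map_id S := hom_ext (fun t => by rw [inX_map, Category.comp_id])
    (fun s hs => by rw [inY_map, Category.comp_id])
  map_comp f g := hom_ext (fun t => by simp only [inX_map, inX_map_assoc])
    (fun s hs => by simp only [inY_map, inY_map_assoc])

/-- Enlarging a lower set by one element `t` amounts to a pushout along any morphism `g : K ⟶ Y_t`
whose source is jointly covered by `X_t` and the `Y_s` with `s < t`. -/
theorem isPushout_insert (hS : IsLowerSet S) {t : T} (ht : t ∉ S) (hS' : S' = insert t S)
    (hlt : Set.Iio t ⊆ S) (h : S ⊆ S') {K : D} (k : K ⟶ partialColimit φ S) (g : K ⟶ Y.obj t)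
    (ix : X.obj t ⟶ K) (iy : ∀ s, s < t → (Y.obj s ⟶ K))
    (hK : ∀ {Z : D} (a b : K ⟶ Z), ix ≫ a = ix ≫ b → (∀ s hs, iy s hs ≫ a = iy s hs ≫ b) → a = b)
    (ixk : ix ≫ k = inX φ S t) (iyk : ∀ s hs, iy s hs ≫ k = inY φ S s (hlt hs))
    (ixg : ix ≫ g = φ.app t) (iyg : ∀ s hs, iy s hs ≫ g = Y.map (homOfLE (le_of_lt hs))) :
    IsPushout k g (map φ h) (inY φ S' t (by simp [hS'])) := by
  classical
  subst hS'
  -- the legs of the new partial cocone at `t` and at `s ∈ S` are compatible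
  have key (c : PushoutCocone k g) (s : T) (hs : s ∈ S) (h : s ≤ t) :
      Y.map (homOfLE h) ≫ c.inr = inY φ S s hs ≫ c.inl := by
    have h' : s < t := lt_of_le_of_ne h (by rintro rfl; exact ht hs)
    have e := iy s h' ≫= c.condition
    rw [reassoc_of% iyk, reassoc_of% iyg] at e
    exact e.symm
  let d (c : PushoutCocone k g) : PartialCocone φ (insert t S) c.pt :=
    { x := fun s => inX φ S s ≫ c.inl
      y := fun s hs => if h : s ∈ S then inY φ S s h ≫ c.inl else
        Y.map (homOfLE (le_of_eq (hs.resolve_right h))) ≫ c.inr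
      x_w := fun h => (cocone φ S).x_w_assoc h _
      y_w := fun {s s'} h hs hs' => by
        by_cases h₁ : s' ∈ S
        · have h₂ : s ∈ S := hS h h₁
          rw [dif_pos h₁, dif_pos h₂]
          exact (cocone φ S).y_w_assoc h h₂ h₁ _
        · rw [dif_neg h₁, ← Functor.map_comp_assoc, homOfLE_comp]
          split_ifs with h₂
          · exact key c _ h₂ _
          · rfl
      app_y := fun s hs => by
        split_ifs with h₁
        · exact (cocone φ S).app_y_assoc s h₁ _
        · obtain rfl : s = t := hs.resolve_right h₁
          have e := ix ≫= c.condition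
          rw [reassoc_of% ixk, reassoc_of% ixg] at e
          rw [e]
          exact congrArg (φ.app s ≫ ·) ((congrArg (· ≫ c.inr) (Y.map_id s)).trans
            (Category.id_comp _)) }
  have hd (c : PushoutCocone k g) (s : T) (hs : s ∈ S) :
      (d c).y s (Or.inr hs) = inY φ S s hs ≫ c.inl := dif_pos hs
  have hd' (c : PushoutCocone k g) : (d c).y t (Or.inl rfl) = c.inr :=
    (dif_neg ht).trans ((congrArg (· ≫ c.inr) (Y.map_id t)).trans (Category.id_comp _))
  refine ⟨⟨hK _ _ ?_ ?_⟩, ⟨PushoutCocone.IsColimit.mk _ (fun c => desc (d c)) ?_ ?_ ?_⟩⟩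
  · rw [reassoc_of% ixk, reassoc_of% ixg, inX_map]
    exact ((cocone φ _).app_y t _).symm
  · intro s hs
    rw [reassoc_of% iyk, reassoc_of% iyg, inY_map]
    exact ((cocone φ _).y_w (le_of_lt hs) _ _).symm
  · intro c
    refine hom_ext (fun s => ?_) (fun s hs => ?_)
    · rw [inX_map_assoc, inX_desc]
    · rw [inY_map_assoc, inY_desc, hd]
  · intro c
    rw [inY_desc, hd']
  · intro c m h₁ h₂
    refine hom_ext (fun s => ?_) (fun s hs => ?_)
    · rw [inX_desc, ← inX_map_assoc h, h₁]
    · rw [inY_desc]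
      obtain rfl | hs := hs
      · rw [h₂, hd']
      · rw [hd c s hs, ← h₁, inY_map_assoc]

/-- Partial colimits commute with directed unions of sets of indices. -/
noncomputable def isColimitMapCocone {J : Type*} [Preorder J] [IsDirectedOrder J] [Nonempty J]
    {G : J ⥤ Set T} (c : Cocone G) (hc : ∀ t ∈ c.pt, ∃ j, t ∈ G.obj j) :
    IsColimit ((functor φ).mapCocone c) := by
  have hX (d : Cocone (G ⋙ functor φ)) {j l : J} (h : j ≤ l) (t : T) :
      inX φ (G.obj j) t ≫ d.ι.app j = inX φ (G.obj l) t ≫ d.ι.app l :=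
    (inX φ (G.obj j) t ≫= d.w (homOfLE h)).symm.trans
      (inX_map_assoc (leOfHom (G.map (homOfLE h))) t (d.ι.app l))
  have hY (d : Cocone (G ⋙ functor φ)) {j l : J} (h : j ≤ l) (t : T) (ht : t ∈ G.obj j) :
      inY φ (G.obj j) t ht ≫ d.ι.app j =
        inY φ (G.obj l) t (leOfHom (G.map (homOfLE h)) ht) ≫ d.ι.app l :=
    (inY φ (G.obj j) t ht ≫= d.w (homOfLE h)).symm.trans
      (inY_map_assoc (leOfHom (G.map (homOfLE h))) t ht (d.ι.app l))
  have hX' (d : Cocone (G ⋙ functor φ)) (j j' : J) (t : T) :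
      inX φ (G.obj j) t ≫ d.ι.app j = inX φ (G.obj j') t ≫ d.ι.app j' := by
    obtain ⟨l, h, h'⟩ := exists_ge_ge j j'
    rw [hX d h, hX d h']
  have hY' (d : Cocone (G ⋙ functor φ)) (j j' : J) (t : T) (h : t ∈ G.obj j)
      (h' : t ∈ G.obj j') :
      inY φ (G.obj j) t h ≫ d.ι.app j = inY φ (G.obj j') t h' ≫ d.ι.app j' := by
    obtain ⟨l, h₁, h₁'⟩ := exists_ge_ge j j'
    rw [hY d h₁, hY d h₁']
  -- the legs at the `X_t` do not depend on the stage, so any stage serves to define them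
  let j₀ : J := Classical.arbitrary J
  let D' (d : Cocone (G ⋙ functor φ)) : PartialCocone φ c.pt d.pt :=
    { x := fun t => inX φ (G.obj j₀) t ≫ d.ι.app j₀
      y := fun t ht => inY φ _ t (hc t ht).choose_spec ≫ d.ι.app (hc t ht).choose
      x_w := fun h => (cocone φ (G.obj j₀)).x_w_assoc h _
      y_w := fun {s s'} h hs hs' => by
        obtain ⟨l, h₁, h₂⟩ := exists_ge_ge (hc s hs).choose (hc s' hs').choose
        have hl : s ∈ G.obj l := leOfHom (G.map (homOfLE h₁)) (hc s hs).choose_spec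
        have hl' : s' ∈ G.obj l := leOfHom (G.map (homOfLE h₂)) (hc s' hs').choose_spec
        rw [hY' d _ l s _ hl, hY' d _ l s' _ hl']
        exact (cocone φ (G.obj l)).y_w_assoc h hl hl' _
      app_y := fun t ht => by
        rw [hX' d j₀ (hc t ht).choose t]
        exact (cocone φ (G.obj _)).app_y_assoc t _ _ }
  refine { desc := fun d => desc (D' d), fac := ?_, uniq := ?_ }
  · intro d j
    refine hom_ext (fun t => ?_) (fun t ht => ?_)
    · exact (inX_map_assoc (leOfHom (c.ι.app j)) t _).trans
        ((inX_desc (D' d) t).trans (hX' d _ _ t))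
    · exact (inY_map_assoc (leOfHom (c.ι.app j)) t ht _).trans
        ((inY_desc (D' d) t _).trans (hY' d _ _ t _ _))
  · intro d m hm
    refine hom_ext (fun t => ?_) (fun t ht => ?_)
    · exact (inX_map_assoc (leOfHom (c.ι.app j₀)) t m).symm.trans
        ((inX φ (G.obj j₀) t ≫= hm j₀).trans (inX_desc (D' d) t).symm)
    · exact (inY_map_assoc (leOfHom (c.ι.app _)) t (hc t ht).choose_spec m).symm.trans
        ((inY φ _ t (hc t ht).choose_spec ≫= hm _).trans (inY_desc (D' d) t ht).symm)

end partialColimit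
end PartialColimit

/-! ### The universal property of the source of the relative latching map -/

section RelativeLatching

variable {D : Type u} [Category.{v} D] {T : Type w} [PartialOrder T] {X Y : T ⥤ D} (φ : X ⟶ Y)

/-- Given a family of morphisms `α s : X_s ⟶ x₀` for `s ∈ S`, a cocone over the diagram formed by
`x₀`, and by `X_s`, `Y_s` for `s ∈ S`. If `S = {s | s < t}` and `x₀ = X_t`, the colimit of this
diagram is the relative latching object `X_t ⨿_{colim_{s < t} X_s} colim_{s < t} Y_s`. -/
structure RelativeCocone {S : Set T} {x₀ : D} (α : ∀ s ∈ S, X.obj s ⟶ x₀) (Z : D) where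
  /-- the leg at `x₀` -/
  x : x₀ ⟶ Z
  /-- the leg at `Y_s` -/
  y (s : T) (hs : s ∈ S) : Y.obj s ⟶ Z
  y_w {s s' : T} (h : s ≤ s') (hs : s ∈ S) (hs' : s' ∈ S) :
    Y.map (homOfLE h) ≫ y s' hs' = y s hs
  app_y (s : T) (hs : s ∈ S) : φ.app s ≫ y s hs = α s hs ≫ x

/-- The morphisms `X_s ⟶ X_t` for `s < t`. -/
abbrev latchingLegs (X : T ⥤ D) (t : T) : ∀ s ∈ Set.Iio t, X.obj s ⟶ X.obj t :=
  fun _ hs => X.map (homOfLE (le_of_lt hs))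

namespace RelativeCocone

variable {φ} {S : Set T} {x₀ : D} {α : ∀ s ∈ S, X.obj s ⟶ x₀} {K L Z : D}

variable (φ) in
/-- The tautological cocone with point `Y_t`. -/
abbrev tautological (t : T) : RelativeCocone φ (latchingLegs X t) (Y.obj t) where
  x := φ.app t
  y s hs := Y.map (homOfLE (le_of_lt hs))
  y_w h hs hs' := by rw [← Functor.map_comp, homOfLE_comp]
  app_y s hs := (φ.naturality _).symm

/-- A morphism from the point of one cocone to the point of another is compatible with the
structure morphisms. -/
structure IsHom (c : RelativeCocone φ α K) (d : RelativeCocone φ α L) (f : K ⟶ L) : Prop where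
  x_comp : c.x ≫ f = d.x
  y_comp (s : T) (hs : s ∈ S) : c.y s hs ≫ f = d.y s hs

/-- The cocone is initial among all cocones, that is, a colimit cocone. Formulated by hand, this
needs no indexing category for the diagram. -/
structure IsUniversal (c : RelativeCocone φ α K) : Prop where
  hom_ext {Z : D} {f g : K ⟶ Z} (hx : c.x ≫ f = c.x ≫ g)
    (hy : ∀ s hs, c.y s hs ≫ f = c.y s hs ≫ g) : f = g
  exists_isHom {Z : D} (d : RelativeCocone φ α Z) : ∃ f, c.IsHom d f

theorem IsHom.comp {c : RelativeCocone φ α K} {d : RelativeCocone φ α L}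
    {e : RelativeCocone φ α Z} {f : K ⟶ L} {g : L ⟶ Z} (hf : c.IsHom d f)
    (hg : d.IsHom e g) : c.IsHom e (f ≫ g) where
  x_comp := by rw [← Category.assoc, hf.x_comp, hg.x_comp]
  y_comp s hs := by rw [← Category.assoc, hf.y_comp, hg.y_comp]

theorem IsHom.id (c : RelativeCocone φ α K) : c.IsHom c (𝟙 K) where
  x_comp := Category.comp_id _
  y_comp _ _ := Category.comp_id _

theorem IsUniversal.isHom_unique {c : RelativeCocone φ α K} (hc : c.IsUniversal)
    {d : RelativeCocone φ α L} {f g : K ⟶ L} (hf : c.IsHom d f) (hg : c.IsHom d g) :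
    f = g :=
  hc.hom_ext (hf.x_comp.trans hg.x_comp.symm)
    fun s hs => (hf.y_comp s hs).trans (hg.y_comp s hs).symm

/-- The comparison morphism to another cocone does not depend, up to isomorphism, on the choice of
the universal cocone. -/
theorem IsUniversal.mem_iff {c : RelativeCocone φ α K} (hc : c.IsUniversal)
    {d : RelativeCocone φ α L} (hd : d.IsUniversal) {e : RelativeCocone φ α Z}
    {f : K ⟶ Z} (hf : c.IsHom e f) {g : L ⟶ Z} (hg : d.IsHom e g) (W : MorphismProperty D)
    [W.RespectsIso] : W f ↔ W g := by
  obtain ⟨i, hi⟩ := hc.exists_isHom d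
  obtain ⟨j, hj⟩ := hd.exists_isHom c
  have : IsIso i :=
    ⟨j, hc.isHom_unique (hi.comp hj) (.id c), hd.isHom_unique (hj.comp hi) (.id d)⟩
  rw [hc.isHom_unique hf (hi.comp hg)]
  exact W.cancel_left_of_respectsIso i g

/-- A universal cocone is obtained by taking the two colimits over `s < t`, followed by a
pushout. -/
theorem exists_isUniversal_of_isPushout {t : T}
    {cX : Cocone ((Set.principalSegIio t).monotone.functor ⋙ X)}
    (hX : IsColimit cX) {cY : Cocone ((Set.principalSegIio t).monotone.functor ⋙ Y)}
    (hY : IsColimit cY) (a : cX.pt ⟶ X.obj t)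
    (ha : ∀ s : Set.Iio t, cX.ι.app s ≫ a = X.map (homOfLE (le_of_lt s.2))) (b : cX.pt ⟶ cY.pt)
    (hb : ∀ s : Set.Iio t, cX.ι.app s ≫ b = φ.app s.1 ≫ cY.ι.app s)
    {i : X.obj t ⟶ K} {j : cY.pt ⟶ K} (sq : IsPushout a b i j) :
    ∃ c : RelativeCocone φ (latchingLegs X t) K, c.IsUniversal ∧ c.x = i ∧
      ∀ s hs, c.y s hs = cY.ι.app ⟨s, hs⟩ ≫ j := by
  refine ⟨{ x := i, y := fun s hs => cY.ι.app ⟨s, hs⟩ ≫ j, y_w := ?_, app_y := ?_ }, ⟨?_, ?_⟩,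
    rfl, fun _ _ => rfl⟩
  · intro s s' h hs hs'
    exact (Category.assoc _ _ _).symm.trans
      (congrArg (· ≫ j) (cY.w (homOfLE h : (⟨s, hs⟩ : Set.Iio t) ⟶ ⟨s', hs'⟩)))
  · intro s hs
    have h₁ := congrArg (· ≫ j) (hb ⟨s, hs⟩)
    have h₂ := congrArg (· ≫ i) (ha ⟨s, hs⟩)
    exact (Category.assoc _ _ _).symm.trans (h₁.symm.trans (((Category.assoc _ _ _).trans
      ((cX.ι.app ⟨s, hs⟩ ≫= sq.w.symm).trans (Category.assoc _ _ _).symm)).trans h₂))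
  · intro Z f g hx hy
    refine sq.hom_ext hx (hY.hom_ext fun s => ?_)
    exact (Category.assoc _ _ _).symm.trans ((hy s.1 s.2).trans (Category.assoc _ _ _))
  · intro Z d
    let dY : Cocone ((Set.principalSegIio t).monotone.functor ⋙ Y) :=
      { pt := Z
        ι :=
          { app := fun s => d.y s.1 s.2
            naturality := fun s s' f =>
              (d.y_w (leOfHom f) s.2 s'.2).trans (Category.comp_id _).symm } }
    have hd : a ≫ d.x = b ≫ hY.desc dY := by
      refine hX.hom_ext fun s => ?_
      refine (Category.assoc _ _ _).symm.trans ((congrArg (· ≫ d.x) (ha s)).trans ?_)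
      refine (d.app_y s.1 s.2).symm.trans ?_
      refine Eq.trans ?_ (Category.assoc _ _ _)
      refine Eq.trans ?_ (congrArg (· ≫ hY.desc dY) (hb s)).symm
      exact (φ.app s.1 ≫= hY.fac dY s).symm.trans (Category.assoc _ _ _).symm
    refine ⟨sq.desc d.x (hY.desc dY) hd, sq.inl_desc _ _ _, fun s hs => ?_⟩
    exact (Category.assoc _ _ _).trans ((cY.ι.app ⟨s, hs⟩ ≫= sq.inr_desc _ _ _).trans
      (hY.fac dY ⟨s, hs⟩))

end RelativeCocone
end RelativeLatching

section

variable {C : Type u} [Category.{v} C] [HasFiniteColimits C]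
  {T : Type w} [PartialOrder T] [IsCofinitePoset T] {X Y : T ⥤ C} (φ : X ⟶ Y)

open RelativeCocone

/-- A functor preserving finite colimits preserves relative latching maps. -/
theorem exists_isUniversal_map_relativeLatchingMap {D : Type*} [Category* D] (F : C ⥤ D)
    [PreservesFiniteColimits F] (t : T) :
    ∃ c : RelativeCocone (Functor.whiskerRight φ F) (latchingLegs _ t)
        (F.obj (pushout (latchingMap X t) (latchingObjMap φ t))),
      c.IsUniversal ∧ c.IsHom (tautological _ t) (F.map (relativeLatchingMap φ t)) := by
  classical
  have := IsCofinitePoset.finite_Iio t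
  let := Fintype.ofFinite (Set.Iio t)
  let : FinCategory (Set.Iio t) :=
    { fintypeHom := fun a b => Fintype.ofFinite (a ⟶ b) }
  have hX := isColimitOfPreserves F (colimit.isColimit (restrictIio X t))
  have hY := isColimitOfPreserves F (colimit.isColimit (restrictIio Y t))
  obtain ⟨c, hc, hx, hy⟩ := exists_isUniversal_of_isPushout (φ := Functor.whiskerRight φ F)
    (cX := F.mapCocone (colimit.cocone (restrictIio X t)))
    (cY := F.mapCocone (colimit.cocone (restrictIio Y t))) hX hY
    (F.map (latchingMap X t))
    (fun s => (F.map_comp _ _).symm.trans (congrArg F.map (colimit.ι_desc _ s)))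
    (F.map (latchingObjMap φ t))
    (fun s => (F.map_comp _ _).symm.trans ((congrArg F.map (ι_colimMap _ s)).trans
      (F.map_comp _ _)))
    ((IsPushout.of_hasPushout (latchingMap X t) (latchingObjMap φ t)).map F)
  refine ⟨c, hc, ?_, fun s hs => ?_⟩
  · rw [hx]
    exact (F.map_comp _ _).symm.trans (congrArg F.map (pushout.inl_desc _ _ _))
  · rw [hy]
    refine (Category.assoc _ _ _).trans ?_
    refine (_ ≫= (F.map_comp _ _).symm).trans ?_
    refine (_ ≫= congrArg F.map (pushout.inr_desc _ _ _)).trans ?_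
    exact (F.map_comp _ _).symm.trans
      (congrArg F.map (colimit.ι_desc _ (⟨s, hs⟩ : Set.Iio t)))

/-- The relative latching map is the comparison morphism from a universal cocone to the
tautological one. -/
theorem exists_isUniversal_relativeLatchingMap (t : T) :
    ∃ c : RelativeCocone φ (latchingLegs X t) (pushout (latchingMap X t) (latchingObjMap φ t)),
      c.IsUniversal ∧ c.IsHom (tautological φ t) (relativeLatchingMap φ t) :=
  exists_isUniversal_map_relativeLatchingMap φ (𝟭 C) t

end

/-! ### Colimits of cospecial maps are relative cell complexes -/

/-- A cofinite partial order extends to a well-order. -/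
theorem IsCofinitePoset.exists_strictMono_equiv (T : Type w) [PartialOrder T] [IsCofinitePoset T] :
    ∃ (L : Type w) (_ : LinearOrder L) (_ : WellFoundedLT L) (e : T ≃ L), StrictMono e := by
  obtain ⟨e⟩ : Nonempty (T ≃ (Cardinal.mk T).ord.ToType) :=
    Cardinal.eq.1 (Cardinal.mk_ord_toType _).symm
  -- compare the number of predecessors first, and break ties by an arbitrary well-order
  let f (t : T) : ℕ ×ₗ (Cardinal.mk T).ord.ToType := toLex ((Set.Iic t).ncard, e t)
  have hf : Function.Injective f := fun s t h => e.injective (congrArg (fun p => (ofLex p).2) h)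
  refine ⟨Set.range f, inferInstance, inferInstance, Equiv.ofInjective f hf, fun s t h => ?_⟩
  refine Subtype.coe_lt_coe.1 (Prod.Lex.toLex_lt_toLex.2 (Or.inl ?_))
  exact Set.ncard_lt_ncard (Set.Iic_ssubset_Iic.2 h) (IsCofinitePoset.finite_Iic t)

/-- If `S` is empty, the partial colimit is `colim X`. -/
noncomputable def partialColimit.isoOfEmpty {D : Type u} [Category.{v} D]
    [HasColimitsOfSize.{w, w} D] {T : Type w} [PartialOrder T] {X Y : T ⥤ D} (φ : X ⟶ Y)
    {S : Set T} (hS : ∀ t, t ∉ S) : partialColimit φ S ≅ colimit X where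
  hom := desc
    { x := colimit.ι X
      y := fun s hs => (hS s hs).elim
      x_w := fun _ => colimit.w _ _
      y_w := fun _ hs => (hS _ hs).elim
      app_y := fun _ hs => (hS _ hs).elim }
  inv := pushout.inl _ _
  hom_inv_id := hom_ext
    (fun t => (inX_desc_assoc _ _ _).trans (Category.comp_id (inX φ S t)).symm)
    (fun s hs => (hS s hs).elim)
  inv_hom_id := colimit.hom_ext fun t =>
    (Category.assoc _ _ _).symm.trans ((inX_desc _ t).trans (Category.comp_id _).symm)

/-- If `S` is everything, the partial colimit is `colim Y`. -/
noncomputable def partialColimit.isoOfUniv {D : Type u} [Category.{v} D]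
    [HasColimitsOfSize.{w, w} D] {T : Type w} [PartialOrder T] {X Y : T ⥤ D} (φ : X ⟶ Y)
    {S : Set T} (hS : ∀ t, t ∈ S) : partialColimit φ S ≅ colimit Y where
  hom := desc
    { x := fun t => φ.app t ≫ colimit.ι Y t
      y := fun s _ => colimit.ι Y s
      x_w := fun _ => by rw [φ.naturality_assoc, colimit.w]
      y_w := fun _ _ _ => colimit.w _ _
      app_y := fun _ _ => rfl }
  inv := colimit.desc Y
    { pt := _
      ι :=
        { app := fun t => inY φ S t (hS t)
          naturality := fun t t' f =>
            ((cocone φ S).y_w (leOfHom f) (hS t) (hS t')).trans (Category.comp_id _).symm } }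
  hom_inv_id := by
    refine hom_ext (fun t => ?_) (fun s hs => ?_)
    · rw [inX_desc_assoc, Category.assoc, colimit.ι_desc, Category.comp_id]
      exact (cocone φ S).app_y t (hS t)
    · rw [inY_desc_assoc, colimit.ι_desc, Category.comp_id]
  inv_hom_id := by
    refine colimit.hom_ext fun t => ?_
    rw [colimit.ι_desc_assoc, inY_desc, Category.comp_id]

section

variable {D : Type u} [Category.{v} D] [HasColimitsOfSize.{w, w} D]
  {T : Type w} [PartialOrder T] [IsCofinitePoset T] {X Y : T ⥤ D} (φ : X ⟶ Y)

open RelativeCocone in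
/-- If all relative latching maps of `φ` are in `W`, then `colim φ` is a transfinite composition of
pushouts of morphisms in `W`. -/
theorem transfiniteCompositions_colimMap (W : MorphismProperty D)
    (hW : ∀ t, ∃ (K : D) (g : K ⟶ Y.obj t) (c : RelativeCocone φ (latchingLegs X t) K),
      W g ∧ c.IsUniversal ∧ c.IsHom (tautological φ t) g) :
    MorphismProperty.transfiniteCompositions.{w} W.pushouts (colimMap φ) := by
  obtain ⟨L, _, _, e, he⟩ := IsCofinitePoset.exists_strictMono_equiv T
  let _ : OrderBot (WithTop L) := WellFoundedLT.toOrderBot _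
  let _ : SuccOrder (WithTop L) := SuccOrder.ofLinearWellFoundedLT _
  -- The stage at `j` contains the indices strictly below `j`, so that the successor of `e t` adds
  -- exactly `t`; the additional top element makes the last stage all of `T`.
  let S (j : WithTop L) : Set T := {t | (e t : WithTop L) < j}
  have hS (j) : IsLowerSet (S j) := fun s t h hs =>
    (WithTop.coe_le_coe.2 (he.monotone h)).trans_lt hs
  let G : WithTop L ⥤ Set T := Monotone.functor (f := S) fun j j' h t ht => lt_of_lt_of_le ht h
  have : (G ⋙ partialColimit.functor φ).IsWellOrderContinuous := by
    refine ⟨fun m hm => ?_⟩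
    have : Nonempty (Set.Iio m) := ⟨⟨⊥, hm.bot_lt⟩⟩
    refine ⟨partialColimit.isColimitMapCocone (φ := φ) ((Set.principalSegIio m).cocone G) ?_⟩
    intro t ht
    exact ⟨⟨Order.succ (e t : WithTop L), hm.succ_lt ht⟩,
      Order.lt_succ_of_not_isMax (not_isMax_of_lt (a := (e t : WithTop L)) (b := m) ht)⟩
  let comp : W.pushouts.TransfiniteCompositionOfShape (WithTop L)
      (partialColimit.map φ (leOfHom (G.map (homOfLE (bot_le : ⊥ ≤ (⊤ : WithTop L)))))) :=
    { F := G ⋙ partialColimit.functor φ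
      isoBot := Iso.refl _
      incl := (coconeOfDiagramTerminal isTerminalTop (G ⋙ partialColimit.functor φ)).ι
      isColimit := colimitOfDiagramTerminal isTerminalTop (G ⋙ partialColimit.functor φ)
      fac := Category.id_comp _
      map_mem := by
        intro j hj
        have hj' : j ≠ ⊤ := by
          rintro rfl
          exact hj isMax_top
        lift j to L using hj'
        obtain ⟨t, rfl⟩ := e.surjective j
        obtain ⟨K, g, c, hg, hc, hcg⟩ := hW t
        have ht : t ∉ S (e t) := lt_irrefl (e t : WithTop L)
        have hlt : Set.Iio t ⊆ S (e t) := fun s hs => WithTop.coe_lt_coe.2 (he hs)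
        have hSt : S (Order.succ (e t : WithTop L)) = insert t (S (e t)) := by
          ext s
          simp only [S, Set.mem_ofPred_eq, Set.mem_insert_iff]
          rw [Order.lt_succ_iff_of_not_isMax hj, le_iff_eq_or_lt, WithTop.coe_inj,
            e.injective.eq_iff]
        obtain ⟨k, hk⟩ := hc.exists_isHom
          (Z := partialColimit φ (S (e t)))
          { x := partialColimit.inX φ _ t
            y := fun s hs => partialColimit.inY φ _ s (hlt hs)
            y_w := fun h hs hs' => (partialColimit.cocone φ _).y_w h _ _
            app_y := fun s hs => ((partialColimit.cocone φ _).app_y s _).trans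
              ((partialColimit.cocone φ _).x_w _).symm }
        exact ⟨_, _, _, _, _, hg, partialColimit.isPushout_insert (hS _) ht hSt hlt _ k g
          c.x c.y (fun a b => hc.hom_ext) hk.x_comp hk.y_comp hcg.x_comp hcg.y_comp⟩ }
  rw [MorphismProperty.transfiniteCompositions_iff]
  refine ⟨WithTop L, inferInstance, inferInstance, inferInstance, inferInstance,
    ⟨comp.ofArrowIso ?_⟩⟩
  have hbot (t : T) : t ∉ S ⊥ := not_lt_bot (α := WithTop L)
  refine Arrow.isoMk (partialColimit.isoOfEmpty φ hbot)
    (partialColimit.isoOfUniv φ fun t => WithTop.coe_lt_top (e t)) ?_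
  refine partialColimit.hom_ext (fun t => ?_) (fun s hs => (hbot s hs).elim)
  refine (partialColimit.inX_desc_assoc (φ := φ) (S := S ⊥) _ t _).trans ((ι_colimMap _ _).trans ?_)
  have e (h : S ⊥ ⊆ S ⊤) : partialColimit.inX φ (S ⊥) t ≫ partialColimit.map φ h ≫
      (partialColimit.isoOfUniv φ fun t => WithTop.coe_lt_top (e t)).hom =
        φ.app t ≫ colimit.ι Y t := by
    rw [partialColimit.inX_map_assoc]
    exact partialColimit.inX_desc _ t
  exact (e _).symm

end

section

variable {C : Type u} [SmallCategory C] [HasFiniteColimits C] (N : MorphismProperty C)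

/-- In `Ind C` the relative latching maps of a cospecial `N`-map become, up to isomorphism, those of
its composition with the Yoneda embedding, which preserves finite colimits. -/
theorem essentiallyCospecial_le_relativeCellComplexes :
    essentiallyCospecial N ≤ relativeCellComplexes (N.strictMap Ind.yoneda) := by
  rintro A B f ⟨T, _, _, _, _, X, Y, φ, hφ, ⟨i⟩⟩
  have h : relativeCellComplexes (N.strictMap Ind.yoneda)
      (colimMap (Functor.whiskerRight φ Ind.yoneda)) :=
    transfiniteCompositions_colimMap _ _ fun t =>
      let ⟨c, hc, hc'⟩ := exists_isUniversal_map_relativeLatchingMap φ Ind.yoneda t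
      ⟨_, _, c, ⟨hφ t⟩, hc, hc'⟩
  rw [relativeCellComplexes, MorphismProperty.transfiniteCompositions_iff] at h ⊢
  obtain ⟨J, _, _, _, _, hJ⟩ := h
  exact ⟨J, _, _, _, _, (MorphismProperty.arrow_mk_iso_iff _ i).2 hJ⟩

end

/-! ### Squares over a morphism -/

section

variable {C : Type*} [Category* C] {D : Type*} [Category* D] (F : C ⥤ D)

/-- The objects of `C ↓ f`: morphisms `x ⟶ y` of `C` together with a commutative square from
`F x ⟶ F y` to `f`. -/
structure SquareOver {A B : D} (f : A ⟶ B) where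
  /-- the source of the morphism of `C` -/
  x : C
  /-- the target of the morphism of `C` -/
  y : C
  /-- the morphism of `C` -/
  p : x ⟶ y
  /-- the horizontal morphism between the sources -/
  a : F.obj x ⟶ A
  /-- the horizontal morphism between the targets -/
  b : F.obj y ⟶ B
  w : F.map p ≫ b = a ≫ f

namespace SquareOver

variable {F} {A B : D} {f : A ⟶ B}

/-- Morphisms in `C ↓ f`: morphisms in the category of morphisms of `C` that are compatible with
the morphisms to `f`. -/
@[ext]
structure Hom (e e' : SquareOver F f) where
  /-- the morphism between the sources -/
  left : e.x ⟶ e'.x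
  /-- the morphism between the targets -/
  right : e.y ⟶ e'.y
  w : left ≫ e'.p = e.p ≫ right := by cat_disch
  left_a : F.map left ≫ e'.a = e.a := by cat_disch
  right_b : F.map right ≫ e'.b = e.b := by cat_disch

attribute [simp] Hom.left_a Hom.right_b

@[simps]
instance : Category (SquareOver F f) where
  Hom := Hom
  id e := { left := 𝟙 _, right := 𝟙 _ }
  comp g h :=
    { left := g.left ≫ h.left
      right := g.right ≫ h.right
      w := by rw [Category.assoc, h.w, ← Category.assoc, g.w, Category.assoc] }

@[ext]
theorem hom_ext {e e' : SquareOver F f} {g h : e ⟶ e'} (h₁ : Hom.left g = Hom.left h)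
    (h₂ : Hom.right g = Hom.right h) : g = h :=
  Hom.ext h₁ h₂

variable (F f) in
/-- The source of the morphism of `C` underlying a square. -/
@[simps]
def xFunctor : SquareOver F f ⥤ C where
  obj e := e.x
  map g := Hom.left g

variable (F f) in
/-- The target of the morphism of `C` underlying a square. -/
@[simps]
def yFunctor : SquareOver F f ⥤ C where
  obj e := e.y
  map g := Hom.right g

variable (F f) in
/-- The morphism of `C` underlying a square, as a natural transformation. -/
@[simps]
def pNatTrans : xFunctor F f ⟶ yFunctor F f where
  app e := e.p
  naturality _ _ g := Hom.w g

end SquareOver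
end

/-! ### A large cospecial map over a given morphism -/

section

variable {D : Type u} [Category.{v} D] {T : Type w} [PartialOrder T] {X Y : T ⥤ D} {φ : X ⟶ Y}

/-- Universal cocones at `t` only depend on the diagram below `t`. -/
theorem RelativeCocone.IsUniversal.restrict {P : Set T} (hP : IsLowerSet P) (t : P) {K : D}
    {c : RelativeCocone φ (latchingLegs X t.1) K} (hc : c.IsUniversal) {g : K ⟶ Y.obj t.1}
    (hg : c.IsHom (tautological φ t.1) g) :
    ∃ d : RelativeCocone (restrictSetMap φ P) (latchingLegs (restrictSet X P) t) K,
      d.IsUniversal ∧ d.IsHom (tautological _ t) g := by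
  refine ⟨{ x := c.x, y := fun s hs => c.y s.1 hs, y_w := fun h hs hs' => c.y_w h hs hs',
            app_y := fun s hs => c.app_y s.1 hs }, ⟨?_, ?_⟩, ⟨hg.x_comp, fun s hs => ?_⟩⟩
  · exact fun hx hy => hc.hom_ext hx fun s hs => hy ⟨s, hP (le_of_lt hs) t.2⟩ hs
  · intro Z d
    obtain ⟨f, hf⟩ := hc.exists_isHom
      { x := d.x
        y := fun s hs => d.y ⟨s, hP (le_of_lt hs) t.2⟩ hs
        y_w := fun h hs hs' => d.y_w (s := ⟨_, hP (le_of_lt hs) t.2⟩)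
          (s' := ⟨_, hP (le_of_lt hs') t.2⟩) h hs hs'
        app_y := fun s hs => d.app_y ⟨s, hP (le_of_lt hs) t.2⟩ hs }
    exact ⟨f, hf.x_comp, fun s hs => hf.y_comp s.1 hs⟩
  · exact hg.y_comp s.1 hs

/-- A universal cocone for the restriction of `φ` to `P` is universal for `φ`, also after
replacing the object `x₀` by an isomorphic one. -/
theorem RelativeCocone.IsUniversal.of_restrict {P : Set T} {S : Set P} {S' : Set T}
    (hS : ∀ s ∈ S', ∃ h : s ∈ P, ⟨s, h⟩ ∈ S) (hS' : ∀ s ∈ S, s.1 ∈ S') {x₀ x₁ K : D}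
    {α : ∀ s ∈ S, X.obj s.1 ⟶ x₀} (i : x₁ ≅ x₀) (α' : ∀ s ∈ S', X.obj s ⟶ x₁)
    (hα : ∀ s hs, α' s hs ≫ i.hom = α ⟨s, (hS s hs).1⟩ (hS s hs).2)
    {c : RelativeCocone (restrictSetMap φ P) α K} (hc : c.IsUniversal) :
    ∃ c' : RelativeCocone φ α' K, c'.IsUniversal ∧ c'.x = i.hom ≫ c.x ∧
      ∀ s hs, c'.y s hs = c.y ⟨s, (hS s hs).1⟩ (hS s hs).2 := by
  refine ⟨{ x := i.hom ≫ c.x, y := fun s hs => c.y ⟨s, (hS s hs).1⟩ (hS s hs).2,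
            y_w := fun {s s'} h hs hs' => c.y_w (s := ⟨s, _⟩) (s' := ⟨s', _⟩) h _ _,
            app_y := fun s hs => ?_ }, ⟨fun {Z a b} hx hy => ?_, fun {Z} d => ?_⟩, rfl,
            fun _ _ => rfl⟩
  · rw [← Category.assoc, hα]
    exact c.app_y ⟨s, _⟩ (hS s hs).2
  · refine hc.hom_ext ?_ fun s hs => hy s.1 (hS' s hs)
    rwa [Category.assoc, Category.assoc, cancel_epi] at hx
  · obtain ⟨a, ha⟩ := hc.exists_isHom
      { x := i.inv ≫ d.x
        y := fun s hs => d.y s.1 (hS' s hs)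
        y_w := fun h hs hs' => d.y_w h _ _
        app_y := fun s hs => by
          rw [← hα s.1 (hS' s hs), Category.assoc, i.hom_inv_id_assoc]
          exact d.app_y s.1 (hS' s hs) }
    refine ⟨a, ?_, fun s hs => ha.y_comp ⟨s, _⟩ (hS s hs).2⟩
    rw [Category.assoc, ha.x_comp, i.hom_inv_id_assoc]

end

section

variable {C : Type u} [Category.{v} C] [HasFiniteColimits C] {T : Type w} [PartialOrder T]
  [IsCofinitePoset T]

open RelativeCocone

/-- Whether the relative latching map is in `N` may be tested on any universal cocone. -/
theorem relativeLatchingMap_mem_iff {X Y : T ⥤ C} {φ : X ⟶ Y} (N : MorphismProperty C)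
    [N.RespectsIso] {t : T} {K : C} {c : RelativeCocone φ (latchingLegs X t) K}
    (hc : c.IsUniversal) {g : K ⟶ Y.obj t} (hg : c.IsHom (tautological φ t) g) :
    N (relativeLatchingMap φ t) ↔ N g :=
  let ⟨_, hc', hg'⟩ := exists_isUniversal_relativeLatchingMap φ t
  hc'.mem_iff hc hg' hg N

instance (P : Set T) : IsCofinitePoset P where
  finite_Iic t := ((IsCofinitePoset.finite_Iic t.1).preimage Subtype.val_injective.injOn).subset
    fun _ hs => hs

variable {D : Type*} [Category* D] {F : C ⥤ D} {A B : D} {f : A ⟶ B}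

/-- A cocone `α` with point `e` over the restriction to `S` of a diagram of squares `X_s ⟶ Y_s`
over `f` is `N`-admissible if the morphism `x ⨿_{colim_S X} colim_S Y ⟶ y` is in `N`, where
`x ⟶ y` is the morphism underlying `e`. -/
def IsAdmissible (N : MorphismProperty C) {T : Type*} [PartialOrder T] (G : T ⥤ SquareOver F f)
    {S : Set T} {e : SquareOver F f} (α : ∀ s ∈ S, G.obj s ⟶ e) : Prop :=
  ∃ (K : C) (q : K ⟶ e.y)
    (c : RelativeCocone (Functor.whiskerLeft G (SquareOver.pNatTrans F f)) (x₀ := e.x)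
      (fun s (hs : s ∈ S) => (α s hs).left) K),
    N q ∧ c.IsUniversal ∧ c.x ≫ q = e.p ∧ ∀ s hs, c.y s hs ≫ q = (α s hs).right

end

open RelativeCocone SquareOver in
/-- For every morphism `f` there is a cospecial `N`-map over `f` in which all `N`-admissible cocones
over finite lower sets occur. -/
theorem exists_isCospecial_extending {C : Type u} [Category.{v} C] [HasFiniteColimits C]
    {D : Type w} [Category.{v} D] (F : C ⥤ D) {A B : D} (f : A ⟶ B) (N : MorphismProperty C)
    [N.RespectsIso] :
    ∃ (T : Type (max u v)) (_ : PartialOrder T) (_ : IsCofinitePoset T) (G : T ⥤ SquareOver F f),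
      IsCospecial N (Functor.whiskerLeft G (SquareOver.pNatTrans F f)) ∧
      ∀ (S : Set T) (_ : S.Finite) (_ : IsLowerSet S) (e : SquareOver F f)
        (α : ∀ s ∈ S, G.obj s ⟶ e)
        (_ : ∀ s s' (h : s ≤ s') (hs : s ∈ S) (hs' : s' ∈ S),
          G.map (homOfLE h) ≫ α s' hs' = α s hs)
        (_ : IsAdmissible N G α),
      ∃ (t : T) (_ : Set.Iio t = S) (i : G.obj t ≅ e),
        ∀ s (h : s ≤ t) (hs : s ∈ S), G.map (homOfLE h) ≫ i.hom = α s hs := by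
  obtain ⟨T, _, _, G, hG⟩ := exists_cofinite_diagram_extending.{v} (SquareOver F f)
  let φ := Functor.whiskerLeft G (SquareOver.pNatTrans F f)
  -- Keep only the indices at and below which the relative latching maps are in `N`. Admissible
  -- cocones are realized at such an index, so none of them is lost.
  let P : Set T := {t | ∀ s ≤ t, N (relativeLatchingMap φ s)}
  have hP : IsLowerSet P := fun t t' h ht s hs => ht s (hs.trans h)
  refine ⟨P, inferInstance, inferInstance, restrictSet G P, ?_, ?_⟩
  · intro t
    obtain ⟨c, hc, hg⟩ := exists_isUniversal_relativeLatchingMap φ t.1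
    obtain ⟨d, hd, hg'⟩ := hc.restrict hP t hg
    exact (relativeLatchingMap_mem_iff N hd hg').2 (t.2 _ le_rfl)
  · rintro S hS hS' e α hα ⟨K, q, c, hq, hc, hcx, hcy⟩
    have hP' {s : T} (hs : s ∈ Subtype.val '' S) : ∃ h : s ∈ P, ⟨s, h⟩ ∈ S := by
      obtain ⟨s, hs, rfl⟩ := hs
      exact ⟨s.2, hs⟩
    obtain ⟨t, ht, i, hi⟩ := hG (Subtype.val '' S) (hS.image _)
      (by
        rintro _ s' h ⟨s, hs, rfl⟩
        exact ⟨⟨s', hP h s.2⟩, hS' (show (⟨s', _⟩ : P) ≤ s from h) hs, rfl⟩) e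
      (fun s hs => α ⟨s, (hP' hs).1⟩ (hP' hs).2) (fun s s' h hs hs' => hα ⟨s, _⟩ ⟨s', _⟩ h _ _)
    have ht' {s : T} (hs : s < t) : s ∈ Subtype.val '' S := ht.subset hs
    have hN : N (relativeLatchingMap φ t) := by
      obtain ⟨c', hc', hx, hy⟩ := RelativeCocone.IsUniversal.of_restrict (φ := φ) (S' := Set.Iio t)
        (fun s hs => hP' (ht' hs)) (fun s hs => ht.symm.subset ⟨s, hs, rfl⟩)
        (α := fun s hs => Hom.left (α s hs)) (x₀ := e.x) ((xFunctor F f).mapIso i)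
        (latchingLegs (G ⋙ xFunctor F f) t)
        (fun s hs => congrArg Hom.left (hi s (le_of_lt hs) (ht' hs))) hc
      let iY : (G ⋙ yFunctor F f).obj t ≅ e.y := (yFunctor F f).mapIso i
      refine (relativeLatchingMap_mem_iff N hc' (g := q ≫ iY.inv) ⟨?_, fun s hs => ?_⟩).2
        ((N.cancel_right_of_respectsIso _ _).2 hq)
      · rw [hx, ← Category.assoc, Iso.comp_inv_eq, Category.assoc]
        exact (_ ≫= hcx).trans (Hom.w i.hom)
      · rw [hy, ← Category.assoc, Iso.comp_inv_eq]
        refine (hcy _ _).trans ?_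
        exact congrArg Hom.right (hi s (le_of_lt hs) (ht' hs)).symm
    have hmem : t ∈ P := by
      intro s hs
      obtain rfl | hs := eq_or_lt_of_le hs
      · exact hN
      · exact (hP' (ht' hs)).1 _ le_rfl
    refine ⟨⟨t, hmem⟩, ?_, i, fun s h hs => hi s.1 h ⟨s, hs, rfl⟩⟩
    ext s
    constructor
    · intro hs
      exact (hP' (ht' hs)).2
    · intro hs
      exact ht.symm.subset ⟨s, hs, rfl⟩

/-! ### Maps from objects of `C` into ind-objects -/

section

variable {C : Type u} [Category.{v} C]

/-- The value of an ind-object at `K` is the set of morphisms from `K`. -/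
noncomputable def Ind.coyonedaObjYonedaIso (K : C) :
    coyoneda.obj (Opposite.op (Ind.yoneda.obj K)) ≅
      Ind.inclusion C ⋙ (evaluation Cᵒᵖ (Type v)).obj (Opposite.op K) :=
  NatIso.ofComponents
    (fun A => Equiv.toIso (Ind.inclusion.fullyFaithful.homEquiv.trans
      (((Ind.yonedaCompInclusion.app K).homCongr (Iso.refl _)).trans yonedaEquiv)))
    (fun {A B} g => by
      ext h
      have e : (Ind.yonedaCompInclusion.app K).inv ≫ (Ind.inclusion C).map (h ≫ g) ≫ 𝟙 _ =
          ((Ind.yonedaCompInclusion.app K).inv ≫ (Ind.inclusion C).map h ≫ 𝟙 _) ≫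
            (Ind.inclusion C).map g := by
        simp only [Functor.map_comp, Category.comp_id, Category.assoc]
      exact (congrArg yonedaEquiv e).trans (yonedaEquiv_comp _ _))

instance Ind.preservesColimitsOfShape_coyoneda (K : C) {J : Type v} [SmallCategory J]
    [IsFiltered J] :
    PreservesColimitsOfShape J (coyoneda.obj (Opposite.op (Ind.yoneda.obj K))) :=
  preservesColimitsOfShape_of_natIso (Ind.coyonedaObjYonedaIso K).symm

/-- A morphism of ind-objects is an isomorphism if it induces bijections on morphisms from all
objects of `C`. -/
theorem Ind.isIso_of_bijective {A B : Ind C} (g : A ⟶ B)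
    (hg : ∀ K : C, Function.Bijective fun h : Ind.yoneda.obj K ⟶ A => h ≫ g) : IsIso g := by
  have : IsIso ((Ind.inclusion C).map g) := by
    rw [NatTrans.isIso_iff_isIso_app]
    intro K
    have e := (Ind.coyonedaObjYonedaIso K.unop).hom.naturality g
    have : IsIso ((coyoneda.obj (Opposite.op (Ind.yoneda.obj K.unop))).map g) :=
      (isIso_iff_bijective _).2 (hg K.unop)
    have : IsIso ((Ind.coyonedaObjYonedaIso K.unop).hom.app A ≫
      ((Ind.inclusion C).map g).app K) := by
      change IsIso (_ ≫ (Ind.inclusion C ⋙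
        (evaluation Cᵒᵖ (Type v)).obj (Opposite.op K.unop)).map g)
      rw [← e]
      infer_instance
    exact IsIso.of_isIso_comp_left ((Ind.coyonedaObjYonedaIso K.unop).hom.app A) _
  exact isIso_of_reflects_iso g (Ind.inclusion C)

end

/-! ### Existence of admissible cocones -/

section

variable {C : Type u} [Category.{v} C] {D : Type*} [Category* D] {F : C ⥤ D} {A B : D}
  {f : A ⟶ B} {N : MorphismProperty C} {T : Type w} [PartialOrder T] {G : T ⥤ SquareOver F f}

open SquareOver

theorem isAdmissible_of_isEmpty {e : SquareOver F f} (he : N e.p)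
    (α : ∀ s ∈ (∅ : Set T), G.obj s ⟶ e) : IsAdmissible N G α :=
  ⟨e.x, e.p, ⟨𝟙 _, fun _ h => h.elim, fun _ h => h.elim, fun _ h => h.elim⟩, he,
    ⟨fun hx _ => by simpa using hx, fun d => ⟨d.x, ⟨Category.id_comp _, fun _ h => h.elim⟩⟩⟩,
    Category.id_comp _, fun _ h => h.elim⟩

/-- A morphism `g : G t₀ ⟶ e` gives an admissible cocone over `{s | s ≤ t₀}` if the morphism
`x ⨿_{X_{t₀}} Y_{t₀} ⟶ y` is in `N`, where `x ⟶ y` is the morphism underlying `e`. -/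
theorem isAdmissible_of_isPushout {t₀ : T} {e : SquareOver F f} (g : G.obj t₀ ⟶ e) {K : C}
    {i : e.x ⟶ K} {j : (G.obj t₀).y ⟶ K} (sq : IsPushout (Hom.left g) (G.obj t₀).p i j)
    (q : K ⟶ e.y) (hq : N q) (hi : i ≫ q = e.p) (hj : j ≫ q = Hom.right g) :
    IsAdmissible N G (S := Set.Iic t₀) (fun _ hs => G.map (homOfLE hs) ≫ g) := by
  have hid : G.map (homOfLE (le_refl t₀)) = 𝟙 _ := G.map_id t₀
  have hidl : Hom.left (G.map (homOfLE (le_refl t₀)) ≫ g) = Hom.left g := by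
    rw [hid, Category.id_comp]
  have hidr : Hom.right (G.map (homOfLE (le_refl t₀))) = 𝟙 _ := by
    rw [hid]; rfl
  refine ⟨K, q,
    { x := i
      y := fun s hs => Hom.right (G.map (homOfLE hs)) ≫ j
      y_w := ?_
      app_y := ?_ }, hq, ⟨?_, ?_⟩, hi, ?_⟩
  · intro s s' h hs hs'
    have e : Hom.right (G.map (homOfLE h)) ≫ Hom.right (G.map (homOfLE hs')) =
        Hom.right (G.map (homOfLE hs)) := congrArg Hom.right (G.map_comp _ _).symm
    exact (Category.assoc _ _ _).symm.trans (congrArg (· ≫ j) e)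
  · intro s hs
    have e := Hom.w (G.map (homOfLE (Set.mem_Iic.1 hs)))
    change (G.obj s).p ≫ Hom.right (G.map (homOfLE (Set.mem_Iic.1 hs))) ≫ j =
      (Hom.left (G.map (homOfLE (Set.mem_Iic.1 hs))) ≫ Hom.left g) ≫ i
    rw [← Category.assoc, ← e, Category.assoc, Category.assoc, sq.w]
  · intro Z a b hx hy
    refine sq.hom_ext hx ?_
    have e : (Hom.right (G.map (homOfLE (le_refl t₀))) ≫ j) ≫ a =
        (Hom.right (G.map (homOfLE (le_refl t₀))) ≫ j) ≫ b := hy t₀ (Set.mem_Iic.2 le_rfl)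
    rwa [hidr, Category.id_comp] at e
  · intro Z d
    have hd : Hom.left g ≫ d.x = (G.obj t₀).p ≫ d.y t₀ (Set.mem_Iic.2 le_rfl) :=
      ((d.app_y t₀ (Set.mem_Iic.2 le_rfl)).trans (congrArg (· ≫ d.x) hidl)).symm
    refine ⟨sq.desc d.x (d.y t₀ (Set.mem_Iic.2 le_rfl)) hd, sq.inl_desc _ _ _, fun s hs => ?_⟩
    exact (Category.assoc _ _ _).trans ((_ ≫= sq.inr_desc _ _ _).trans
      (d.y_w (Set.mem_Iic.1 hs) hs (Set.mem_Iic.2 le_rfl)))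
  · intro s hs
    exact (Category.assoc _ _ _).trans (_ ≫= hj)

/-- Over every finite set there is an admissible cocone, given by the colimits. -/
theorem exists_isAdmissible [HasFiniteColimits C] [PreservesFiniteColimits F]
    [N.ContainsIdentities] (S : Set T) (hS : S.Finite) :
    ∃ (e : SquareOver F f) (α : ∀ s ∈ S, G.obj s ⟶ e),
      (∀ s s' (h : s ≤ s') (hs : s ∈ S) (hs' : s' ∈ S),
        G.map (homOfLE h) ≫ α s' hs' = α s hs) ∧ IsAdmissible N G α := by
  classical
  have := hS.to_subtype
  let := Fintype.ofFinite S
  let : FinCategory S := { fintypeHom := fun a b => Fintype.ofFinite (a ⟶ b) }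
  let GS : S ⥤ SquareOver F f := restrictSet G S
  let p : GS ⋙ xFunctor F f ⟶ GS ⋙ yFunctor F f := Functor.whiskerLeft GS (pNatTrans F f)
  let cX := colimit.cocone (GS ⋙ xFunctor F f)
  let cY := colimit.cocone (GS ⋙ yFunctor F f)
  have hX : IsColimit cX := colimit.isColimit _
  have hY : IsColimit cY := colimit.isColimit _
  have hFX := isColimitOfPreserves F hX
  have hFY := isColimitOfPreserves F hY
  let cA : Cocone ((GS ⋙ xFunctor F f) ⋙ F) :=
    { pt := A
      ι :=
        { app := fun s => (GS.obj s).a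
          naturality := fun s s' h => (Hom.left_a (GS.map h)).trans (Category.comp_id _).symm } }
  let cB : Cocone ((GS ⋙ yFunctor F f) ⋙ F) :=
    { pt := B
      ι :=
        { app := fun s => (GS.obj s).b
          naturality := fun s s' h => (Hom.right_b (GS.map h)).trans (Category.comp_id _).symm } }
  have hp (s : S) : cX.ι.app s ≫ colimMap p = (GS.obj s).p ≫ cY.ι.app s := ι_colimMap _ _
  let e : SquareOver F f :=
    { x := cX.pt
      y := cY.pt
      p := colimMap p
      a := hFX.desc cA
      b := hFY.desc cB
      w := by
        refine hFX.hom_ext fun s => ?_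
        have e₁ : F.map (cX.ι.app s) ≫ F.map (colimMap p) =
            F.map (GS.obj s).p ≫ F.map (cY.ι.app s) :=
          (F.map_comp _ _).symm.trans ((congrArg F.map (hp s)).trans (F.map_comp _ _))
        have e₂ : F.map (cX.ι.app s) ≫ hFX.desc cA = (GS.obj s).a := hFX.fac cA s
        have e₃ : F.map (cY.ι.app s) ≫ hFY.desc cB = (GS.obj s).b := hFY.fac cB s
        exact (Category.assoc _ _ _).symm.trans ((congrArg (· ≫ hFY.desc cB) e₁).trans
          ((Category.assoc _ _ _).trans ((_ ≫= e₃).trans ((GS.obj s).w.trans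
            ((congrArg (· ≫ f) e₂).symm.trans (Category.assoc _ _ _)))))) }
  let α (s : T) (hs : s ∈ S) : G.obj s ⟶ e :=
    { left := cX.ι.app ⟨s, hs⟩
      right := cY.ι.app ⟨s, hs⟩
      w := hp ⟨s, hs⟩
      left_a := hFX.fac cA ⟨s, hs⟩
      right_b := hFY.fac cB ⟨s, hs⟩ }
  refine ⟨e, α, ?_, ?_⟩
  · intro s s' h hs hs'
    exact SquareOver.hom_ext (cX.w (homOfLE h : (⟨s, hs⟩ : S) ⟶ ⟨s', hs'⟩))
      (cY.w (homOfLE h : (⟨s, hs⟩ : S) ⟶ ⟨s', hs'⟩))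
  · refine ⟨e.y, 𝟙 _,
      { x := e.p
        y := fun s hs => cY.ι.app ⟨s, hs⟩
        y_w := fun {s s'} h hs hs' => cY.w (homOfLE h : (⟨s, hs⟩ : S) ⟶ ⟨s', hs'⟩)
        app_y := fun s hs => (hp ⟨s, hs⟩).symm }, N.id_mem _, ⟨?_, ?_⟩, Category.comp_id _,
        fun _ _ => Category.comp_id _⟩
    · intro Z a b _ hy
      exact hY.hom_ext fun s => hy s.1 s.2
    · intro Z d
      let dY : Cocone (GS ⋙ yFunctor F f) :=
        { pt := Z
          ι :=
            { app := fun s => d.y s.1 s.2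
              naturality := fun s s' h =>
                (d.y_w (leOfHom h) s.2 s'.2).trans (Category.comp_id _).symm } }
      refine ⟨hY.desc dY, hX.hom_ext fun s => ?_, fun s hs => hY.fac dY ⟨s, hs⟩⟩
      refine (Category.assoc _ _ _).symm.trans ((congrArg (· ≫ hY.desc dY) (hp s)).trans ?_)
      refine (Category.assoc _ _ _).trans ((_ ≫= hY.fac dY s).trans ?_)
      exact d.app_y s.1 s.2

end

/-! ### Factorization of morphisms of ind-objects -/

section

variable {C : Type u} [SmallCategory C]

namespace SquareOver

variable {A B : Ind C} {f : A ⟶ B} {T : Type u} [SmallCategory T] [IsFiltered T]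
  (G : T ⥤ SquareOver Ind.yoneda f)

/-- The morphism `colim X ⟶ A` induced by a diagram of squares `X_t ⟶ Y_t` over `f : A ⟶ B`. -/
noncomputable def descA : colimit ((G ⋙ xFunctor Ind.yoneda f) ⋙ Ind.yoneda) ⟶ A :=
  colimit.desc _
    { pt := A
      ι :=
        { app := fun t => (G.obj t).a
          naturality := fun _ _ h => (Hom.left_a (G.map h)).trans (Category.comp_id _).symm } }

/-- The morphism `colim Y ⟶ B` induced by a diagram of squares `X_t ⟶ Y_t` over `f : A ⟶ B`. -/
noncomputable def descB : colimit ((G ⋙ yFunctor Ind.yoneda f) ⋙ Ind.yoneda) ⟶ B :=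
  colimit.desc _
    { pt := B
      ι :=
        { app := fun t => (G.obj t).b
          naturality := fun _ _ h => (Hom.right_b (G.map h)).trans (Category.comp_id _).symm } }

/-- The coprojection of `X_t` into `colim X`, for a diagram of squares `X_t ⟶ Y_t` over `f`. -/
noncomputable def ιX (t : T) : Ind.yoneda.obj (G.obj t).x ⟶
    colimit ((G ⋙ xFunctor Ind.yoneda f) ⋙ Ind.yoneda) :=
  colimit.ι ((G ⋙ xFunctor Ind.yoneda f) ⋙ Ind.yoneda) t

/-- The coprojection of `Y_t` into `colim Y`, for a diagram of squares `X_t ⟶ Y_t` over `f`. -/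
noncomputable def ιY (t : T) : Ind.yoneda.obj (G.obj t).y ⟶
    colimit ((G ⋙ yFunctor Ind.yoneda f) ⋙ Ind.yoneda) :=
  colimit.ι ((G ⋙ yFunctor Ind.yoneda f) ⋙ Ind.yoneda) t

theorem ιX_descA (t : T) : ιX G t ≫ descA G = (G.obj t).a := colimit.ι_desc _ _

theorem ιY_descB (t : T) : ιY G t ≫ descB G = (G.obj t).b := colimit.ι_desc _ _

theorem map_ιX {t t' : T} (h : t ⟶ t') :
    Ind.yoneda.map (Hom.left (G.map h)) ≫ ιX G t' = ιX G t :=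
  colimit.w ((G ⋙ xFunctor Ind.yoneda f) ⋙ Ind.yoneda) h

theorem map_ιY {t t' : T} (h : t ⟶ t') :
    Ind.yoneda.map (Hom.right (G.map h)) ≫ ιY G t' = ιY G t :=
  colimit.w ((G ⋙ yFunctor Ind.yoneda f) ⋙ Ind.yoneda) h

theorem exists_comp_ιX {K : C}
    (h : Ind.yoneda.obj K ⟶ colimit ((G ⋙ xFunctor Ind.yoneda f) ⋙ Ind.yoneda)) :
    ∃ (t : T) (k : K ⟶ (G.obj t).x), Ind.yoneda.map k ≫ ιX G t = h := by
  obtain ⟨t, k, hk⟩ := exists_hom_of_preservesColimit_coyoneda (colimit.isColimit _) h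
  obtain ⟨k, rfl⟩ := Ind.yoneda.map_surjective k
  exact ⟨t, k, hk⟩

theorem exists_comp_ιY {K : C}
    (h : Ind.yoneda.obj K ⟶ colimit ((G ⋙ yFunctor Ind.yoneda f) ⋙ Ind.yoneda)) :
    ∃ (t : T) (k : K ⟶ (G.obj t).y), Ind.yoneda.map k ≫ ιY G t = h := by
  obtain ⟨t, k, hk⟩ := exists_hom_of_preservesColimit_coyoneda (colimit.isColimit _) h
  obtain ⟨k, rfl⟩ := Ind.yoneda.map_surjective k
  exact ⟨t, k, hk⟩

theorem colimMap_descB :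
    colimMap (Functor.whiskerRight (Functor.whiskerLeft G (pNatTrans Ind.yoneda f)) Ind.yoneda) ≫
      descB G = descA G ≫ f := by
  refine colimit.hom_ext fun t => ?_
  refine (ι_colimMap_assoc _ _ _).trans ?_
  refine (_ ≫= ιY_descB G t).trans ((G.obj t).w.trans ?_)
  exact (congrArg (· ≫ f) (ιX_descA G t)).symm.trans (Category.assoc _ _ _)

/-- Every morphism `(G t₀).x ⟶ x'` over `A` extends to a morphism of squares whose left-hand part
it is, by a pushout. -/
theorem exists_hom_of_left [HasFiniteColimits C] {D : Type*} [Category* D] {F : C ⥤ D}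
    [PreservesFiniteColimits F] {A B : D} {f : A ⟶ B} (e : SquareOver F f) {x' : C} (l : e.x ⟶ x')
    (a' : F.obj x' ⟶ A) (h : F.map l ≫ a' = e.a) :
    ∃ (y' : C) (p : x' ⟶ y') (b' : F.obj y' ⟶ B) (w : F.map p ≫ b' = a' ≫ f)
      (g : e ⟶ ⟨x', y', p, a', b', w⟩), Hom.left g = l ∧
        IsPushout (Hom.left g) e.p p (Hom.right g) := by
  have sq := IsPushout.of_hasPushout l e.p
  have sqF := sq.map F
  have hw : F.map l ≫ a' ≫ f = F.map e.p ≫ e.b := by rw [reassoc_of% h, e.w]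
  exact ⟨_, pushout.inl _ _, sqF.desc (a' ≫ f) e.b hw, sqF.inl_desc _ _ _,
    { left := l, right := pushout.inr _ _, w := sq.w, left_a := h,
      right_b := sqF.inr_desc _ _ _ }, rfl, sq⟩

end SquareOver

open SquareOver

/-- Every morphism of ind-objects is, up to an isomorphism of its source, the composite of a
cospecial `N`-map and a morphism with the right lifting property with respect to `N`. -/
theorem Ind.exists_isCospecial_comp_rlp [HasFiniteColimits C] (N : MorphismProperty C)
    [N.ContainsIdentities] [N.IsStableUnderCobaseChange] {A B : Ind C} (f : A ⟶ B) :
    ∃ (T : Type u) (_ : PartialOrder T) (_ : IsCofinitePoset T) (_ : Nonempty T)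
      (_ : IsDirectedOrder T) (X Y : T ⥤ C) (φ : X ⟶ Y) (i : (Ind.lim T).obj X ⟶ A)
      (g : (Ind.lim T).obj Y ⟶ B),
      IsCospecial N φ ∧ IsIso i ∧ (N.strictMap Ind.yoneda).rlp g ∧
        (Ind.lim T).map φ ≫ g = i ≫ f := by
  obtain ⟨T, _, _, G, hG, hext⟩ := exists_isCospecial_extending Ind.yoneda f N
  -- colimits of the finite stages provide upper bounds, so that `T` is directed
  have hub (S : Set T) (hS : S.Finite) (hS' : IsLowerSet S) : ∃ t, ∀ s ∈ S, s < t := by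
    obtain ⟨e, α, hα, hα'⟩ := exists_isAdmissible (N := N) (G := G) S hS
    obtain ⟨t, ht, _⟩ := hext S hS hS' e α hα hα'
    exact ⟨t, fun s hs => ht.symm.subset hs⟩
  have : Nonempty T := ⟨(hub ∅ Set.finite_empty isLowerSet_empty).choose⟩
  have : IsDirectedOrder T := ⟨fun t t' => by
    obtain ⟨m, hm⟩ := hub (Set.Iic t ∪ Set.Iic t')
      ((IsCofinitePoset.finite_Iic t).union (IsCofinitePoset.finite_Iic t'))
      ((isLowerSet_Iic t).union (isLowerSet_Iic t'))
    exact ⟨m, (hm t (Or.inl le_rfl)).le, (hm t' (Or.inr le_rfl)).le⟩⟩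
  -- admissible morphisms out of a stage are, up to isomorphism, transition morphisms
  have hext₁ {t₀ : T} {e : SquareOver Ind.yoneda f} (g : G.obj t₀ ⟶ e)
      (hg : IsAdmissible N G (S := Set.Iic t₀) (fun _ hs => G.map (homOfLE hs) ≫ g)) :
      ∃ (t : T) (h : t₀ ⟶ t) (i : e ⟶ G.obj t), G.map h = g ≫ i := by
    obtain ⟨t, ht, i, hi⟩ := hext (Set.Iic t₀) (IsCofinitePoset.finite_Iic t₀) (isLowerSet_Iic t₀)
      e _ (fun s s' h hs hs' =>
        (Category.assoc _ _ _).symm.trans (congrArg (· ≫ g) (G.map_comp _ _).symm)) hg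
    have h : t₀ ≤ t := le_of_lt (ht.symm.subset (Set.mem_Iic.2 le_rfl))
    refine ⟨t, homOfLE h, i.inv, ?_⟩
    rw [Iso.eq_comp_inv]
    exact (hi t₀ h le_rfl).trans ((congrArg (· ≫ g) (G.map_id t₀)).trans (Category.id_comp g))
  refine ⟨T, inferInstance, inferInstance, inferInstance, inferInstance, _, _, _, descA G, descB G,
    hG, Ind.isIso_of_bijective _ fun K => ⟨?_, ?_⟩, ?_, colimMap_descB G⟩
  · intro (h₁ : _ ⟶ colimit ((G ⋙ xFunctor Ind.yoneda f) ⋙ Ind.yoneda))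
      (h₂ : _ ⟶ colimit ((G ⋙ xFunctor Ind.yoneda f) ⋙ Ind.yoneda))
      (hh : h₁ ≫ descA G = h₂ ≫ descA G)
    change h₁ = h₂
    obtain ⟨t₁, k₁, rfl⟩ := exists_comp_ιX G h₁
    obtain ⟨t₂, k₂, rfl⟩ := exists_comp_ιX G h₂
    obtain ⟨t, l₁, l₂⟩ := exists_ge_ge t₁ t₂
    rw [← map_ιX G (homOfLE l₁), ← map_ιX G (homOfLE l₂)] at hh ⊢
    simp only [← Category.assoc, ← Functor.map_comp] at hh ⊢
    set m₁ := k₁ ≫ Hom.left (G.map (homOfLE l₁))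
    set m₂ := k₂ ≫ Hom.left (G.map (homOfLE l₂))
    rw [Category.assoc, Category.assoc, ιX_descA] at hh
    -- the two morphisms agree after passing to a square with left-hand part their coequalizer
    obtain ⟨a', ha'⟩ := Cofork.IsColimit.desc'
      (isColimitOfHasCoequalizerOfPreservesColimit Ind.yoneda m₁ m₂) (G.obj t).a hh
    obtain ⟨y', p, b', w, g, hg, sq⟩ := exists_hom_of_left (G.obj t) (coequalizer.π m₁ m₂) a' ha'
    obtain ⟨t', h, i, hi⟩ := hext₁ g
      (isAdmissible_of_isPushout g sq (𝟙 _) (N.id_mem _) (Category.comp_id _) (Category.comp_id _))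
    have e : Hom.left (G.map h) = coequalizer.π m₁ m₂ ≫ Hom.left i := by
      rw [hi, ← hg]; rfl
    have e' : m₁ ≫ Hom.left (G.map h) = m₂ ≫ Hom.left (G.map h) := by
      rw [e, coequalizer.condition_assoc]
    rw [← map_ιX G h, ← Functor.map_comp_assoc, e', Functor.map_comp_assoc]
  · intro h
    -- `colim X ⟶ A` is surjective on morphisms from `K`: the square with underlying morphism `𝟙 K`
    -- is admissible over the empty set
    obtain ⟨t, -, i, -⟩ := hext ∅ Set.finite_empty isLowerSet_empty
      ⟨K, K, 𝟙 K, h, h ≫ f, by rw [CategoryTheory.Functor.map_id, Category.id_comp]⟩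
      (fun s hs => hs.elim) (fun s s' h hs => hs.elim) (isAdmissible_of_isEmpty (N.id_mem _) _)
    refine ⟨Ind.yoneda.map (Hom.left i.inv) ≫ ιX G t, ?_⟩
    exact (Category.assoc _ _ _).trans ((_ ≫= ιX_descA G t).trans (Hom.left_a i.inv))
  · rintro K L _ ⟨hi⟩
    rename_i j
    refine ⟨fun {u v} sq => ?_⟩
    change _ ⟶ colimit ((G ⋙ yFunctor Ind.yoneda f) ⋙ Ind.yoneda) at u
    obtain ⟨t, k, rfl⟩ := exists_comp_ιY G u
    have hw : Ind.yoneda.map k ≫ (G.obj t).b = Ind.yoneda.map j ≫ v := by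
      rw [← ιY_descB G t, ← Category.assoc]
      exact sq.w
    -- solve the lifting problem at a later stage, by attaching `j` to `Y_t` along `k`
    have sqP := IsPushout.of_hasPushout k j
    have sqF := sqP.map Ind.yoneda
    let e : SquareOver Ind.yoneda f :=
      { x := (G.obj t).x
        y := pushout k j
        p := (G.obj t).p ≫ pushout.inl k j
        a := (G.obj t).a
        b := sqF.desc _ _ hw
        w := by rw [Functor.map_comp, Category.assoc, sqF.inl_desc, (G.obj t).w] }
    let g : G.obj t ⟶ e :=
      { left := 𝟙 _
        right := pushout.inl k j
        w := Category.id_comp _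
        left_a := by rw [CategoryTheory.Functor.map_id, Category.id_comp]
        right_b := sqF.inl_desc _ _ _ }
    have hinl : N (pushout.inl k j) := N.of_isPushout sqP hi
    obtain ⟨t', h, i, hi⟩ := hext₁ g
      (isAdmissible_of_isPushout g (i := (G.obj t).p) (j := 𝟙 _)
        (IsPushout.of_horiz_isIso ⟨(Category.id_comp _).trans (Category.comp_id _).symm⟩)
        (pushout.inl k j) hinl rfl (Category.id_comp _))
    have e₁ : Hom.right (G.map h) = pushout.inl k j ≫ Hom.right i := by
      rw [hi]; rfl
    have e₂ : k ≫ Hom.right (G.map h) = j ≫ pushout.inr k j ≫ Hom.right i := by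
      rw [e₁, pushout.condition_assoc]
    refine CommSq.HasLift.mk'
      { l := Ind.yoneda.map (pushout.inr k j ≫ Hom.right i) ≫ ιY G t'
        fac_left := ?_
        fac_right := ?_ }
    · refine Eq.trans ?_ (_ ≫= map_ιY G h)
      exact (Category.assoc _ _ _).symm.trans
        ((congrArg (· ≫ ιY G t') ((Functor.map_comp _ _ _).symm.trans
          ((congrArg Ind.yoneda.map e₂.symm).trans (Functor.map_comp _ _ _)))).trans
            (Category.assoc _ _ _))
    · exact (Category.assoc _ _ _).trans ((_ ≫= ιY_descB G t').trans
        ((congrArg (· ≫ (G.obj t').b) (Functor.map_comp _ _ _)).trans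
          ((Category.assoc _ _ _).trans
            ((_ ≫= Hom.right_b i).trans (sqF.inr_desc _ _ _)))))

end

/-! ### Comparison of the two classes -/

section

variable {C : Type u} [SmallCategory C]

theorem relativeCellComplexes_le_llp_rlp {D : Type u} [Category.{v} D] (W : MorphismProperty D) :
    relativeCellComplexes W ≤ W.rlp.llp := by
  rw [← W.rlp_pushouts]
  exact MorphismProperty.transfiniteCompositions_le_llp_rlp.{v} W.pushouts

/-- The retract argument: a morphism with the left lifting property with respect to the second
factor of its factorization is a retract of the first one. -/
theorem llp_rlp_le_retracts_essentiallyCospecial [HasFiniteColimits C] (N : MorphismProperty C)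
    [N.ContainsIdentities] [N.IsStableUnderCobaseChange] :
    (N.strictMap Ind.yoneda).rlp.llp ≤ (essentiallyCospecial N).retracts := by
  intro A B f hf
  obtain ⟨T, _, _, _, _, X, Y, φ, i, g, hφ, _, hg, w⟩ := Ind.exists_isCospecial_comp_rlp N f
  have := hf g hg
  have h : (inv i ≫ (Ind.lim T).map φ) ≫ g = f := by
    rw [Category.assoc, w, IsIso.inv_hom_id_assoc]
  refine ⟨_, _, _, RetractArrow.ofLeftLiftingProperty h, ⟨T, _, ‹_›, ‹_›, ‹_›, X, Y, φ, hφ, ⟨?_⟩⟩⟩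
  exact Arrow.isoMk (asIso (inv i)) (Iso.refl _) (Category.comp_id _).symm

end

theorem propositionc {C : Type u} [SmallCategory C] [HasFiniteColimits C]
    (N : MorphismProperty C) [N.IsMultiplicative] [N.IsStableUnderCobaseChange]
    (hN : MorphismProperty.isomorphisms C ≤ N) :
    (relativeCellComplexes (N.strictMap Ind.yoneda)).retracts = (essentiallyCospecial N).retracts := by
  refine le_antisymm ?_ ?_
  · refine le_trans ?_ (llp_rlp_le_retracts_essentiallyCospecial N)
    exact MorphismProperty.retracts_le_iff.2 (relativeCellComplexes_le_llp_rlp _)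
  · exact MorphismProperty.retracts_monotone (essentiallyCospecial_le_relativeCellComplexes N)
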